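/- **Model.** Time is slotted, $t=0,1,2,\dots$. Fix constants $T,W,\delta_{\rm s},C,\kappa_{\rm c},\kappa_{\rm e},e_{\rm unit},\lambda_{\rm e},\lambda_{\rm c},\Omega>0$, constants $P_{\rm B},r_{\max},p_{\max},f^{\rm u}_{\max},f^{\rm s}_{\max},E^{\rm h}_{\max},B_{\min},c_{\rm th}\ge0$, and real $\delta_{\rm p},\Gamma_{\rm th}$ with $W\delta_{\rm p}^2\le\Gamma_{\rm th}$. The random events $\omega_t=(a_t,e^{\rm h}_t,h_t,\bar g_t,\bar h_t)$ are i.i.d. with law $\mu$, with $a_t\in\{0,1\}$, $0\le e^{\rm h}_t\le E^{\rm h}_{\max}$ and $h_t,\bar g_t,\bar h_t\ge0$ almost surely. An action is $(r_t,p_t,f^{\rm u}_t,f^{\rm s}_t)$. Put $$\gamma_t=\frac{h_t}{a_tP_{\rm B}\bar g_t+W\delta_{\rm s}^2},\quad l^{\rm off}_t=WT\log_2(1+p_t\gamma_t),\quad l^{\rm loc}_t=\frac{f^{\rm u}_tT}{C},\quad l^{\rm edg}_t=\frac{f^{\rm s}_tT}{C},$$ $$e^{\rm edg}_t=\kappa_{\rm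 e}(f^{\rm s}_t)^3T,\qquad e^{\rm u}_t=e_{\rm unit}r_t+p_tT+\kappa_{\rm c}(f^{\rm u}_t)^3T .$$ From deterministic initial values $Q^{\rm U}_0,Q^{\rm S}_0,Z_0\ge0$ and $0\le B_0\le\Omega$, the data queues $Q^{\rm U},Q^{\rm S}$, the battery level $B$ and the virtual power-deficit queue $Z$ evolve by $$Q^{\rm U}_{t+1}=Q^{\rm U}_t-l^{\rm off}_t-l^{\rm loc}_t+r_t,\qquad Q^{\rm S}_{t+1}=Q^{\rm S}_t-l^{\rm edg}_t+l^{\rm off}_t,$$ $$B_{t+1}=\min(B_t-\lambda_{\rm e}e^{\rm u}_t+\lambda_{\rm e}e^{\rm h}_t,\Omega),\qquad Z_{t+1}=\max(Z_t+\lambda_{\rm c}e^{\rm edg}_t-\lambda_{\rm c}c_{\rm th},0).$$ The *box constraints* are $0\le r_t\le r_{\max}$, $0\le p_t\le p_{\max}$, $0\le f^{\rm u}_t\le f^{\rm u}_{\max}$, $0\le f^{\rm s}_t\le f^{\rm s}_{\max}$; the *QoS constraint* is $a_t(W\delta_{\rm p}^2+p_t\bar h_t-\Gamma_{\rm th})\le0$;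 *data causality* is $0\le l^{\rm off}_t+l^{\rm loc}_t\le Q^{\rm U}_t$ and $0\le l^{\rm edg}_t\le Q^{\rm S}_t$; *energy causality* is $0\le\lambda_{\rm e}e^{\rm u}_t\le B_t\mathbf 1_{\{B_t\ge B_{\min}\}}$. A process $X_t$ is *strongly stable* if every $X_t$ is integrable and $\limsup_N\frac1N\sum_{t<N}\mathbb E|X_t|<\infty$. The *power constraint* is $\limsup_N\frac1N\sum_{t<N}\mathbb E[e^{\rm edg}_t]\le c_{\rm th}$. A policy chooses the action of slot $t$ as a measurable function of $\omega_0,\dots,\omega_t$ and of an independent random seed, uniform on $[0,1]$. Consider policies that satisfy, almost surely in every slot, the box, QoS and data causality constraints, for which $Q^{\rm U},Q^{\rm S}$ are strongly stable, and which satisfy the power constraint. Let $\bar R^*_{\rm P1}$ be the supremum of $\limsup_N\frac1N\sum_{t<N}\mathbb E[r_t]$ over those of these policies that satisfy energy causality almost surely in every slot, and $\bar R^*_{\rm P2}$ the supremum over those that satisfy instead $\limsup_N\frac1N\sum_{t<N}\mathbb E[e^{\rm u}_t-e^{\rm h}_t]\le0$. For $V>0$, *PLySE* chooses in every slot, given the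 backlogs and $\omega_t$, a maximizer of $$Vr_t+Z_t\lambda_{\rm c}(c_{\rm th}-e^{\rm edg}_t)+\lambda_{\rm e}(B_t-\Omega)(e^{\rm u}_t-e^{\rm h}_t)+Q^{\rm U}_t(l^{\rm off}_t+l^{\rm loc}_t-r_t)+Q^{\rm S}_t(l^{\rm edg}_t-l^{\rm off}_t)$$ subject to the box, QoS and data causality constraints. Put $\ell(\omega_t)=WT\log_2(1+p_{\max}\gamma_t)$, assume $\mathbb E[\ell(\omega_t)^2]<\infty$, and put $l^{\rm loc}_{\max}=f^{\rm u}_{\max}T/C$, $l^{\rm edg}_{\max}=f^{\rm s}_{\max}T/C$, $e^{\rm edg}_{\max}=\kappa_{\rm e}(f^{\rm s}_{\max})^3T$, $e^{\rm u}_{\max}=e_{\rm unit}r_{\max}+p_{\max}T+\kappa_{\rm c}(f^{\rm u}_{\max})^3T$ and $$D=\tfrac12\Big[(\lambda_{\rm c}e^{\rm edg}_{\max})^2+(\lambda_{\rm c}c_{\rm th})^2+(\lambda_{\rm e}e^{\rm u}_{\max})^2+(\lambda_{\rm e}E^{\rm h}_{\max})^2+\mathbb E\big[(\ell(\omega_t)+l^{\rm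 loc}_{\max})^2\big]+r_{\max}^2+(l^{\rm edg}_{\max})^2+\mathbb E\big[\ell(\omega_t)^2\big]\Big].$$ **Slater condition.** There are $\epsilon>0$, $\varphi(\epsilon)\in\mathbb R$ and a stationary randomized policy $\Gamma$, which draws its action from a distribution depending only on $\omega_t$ and almost surely meets the box and QoS constraints, such that $\mathbb E[r^\Gamma_t]=\varphi(\epsilon)$, $\mathbb E[e^{\rm edg,\Gamma}_t]\le c_{\rm th}-\epsilon$, $\mathbb E[e^{\rm u,\Gamma}_t-e^{\rm h}_t]\le-\epsilon$, $\mathbb E[l^{\rm off,\Gamma}_t]\le\mathbb E[l^{\rm edg,\Gamma}_t]-\epsilon$ and $\mathbb E[r^\Gamma_t]\le\mathbb E[l^{\rm off,\Gamma}_t+l^{\rm loc,\Gamma}_t]-\epsilon$. **Proposition.** Under the Slater condition, for every $V>0$, PLySE satisfies: a) $\displaystyle\liminf_{N\to\infty}\frac1N\sum_{t<N}\mathbb E[r_t]\ge\bar R^*_{\rm P1}-\frac DV$. b) $Q^{\rm U}$ and $Q^{\rm S}$ are strongly stable, and for $Q\in\{Q^{\rm U},Q^{\rm S}\}$ $$\limsup_{N\to\infty}\frac1N\sum_{t<N}\mathbb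 E[Q_t]\le\frac{D+V(\bar R^*_{\rm P2}-\varphi(\epsilon))}{\epsilon};$$ if PLySE satisfies energy causality almost surely in every slot, then moreover $$\limsup_{N\to\infty}\frac1N\sum_{t<N}\mathbb E[Q_t]\le\frac{D+V(\bar R^*_{\rm P1}-\varphi(\epsilon))}{\epsilon}.$$ Energy causality does hold almost surely in every slot whenever the battery capacity satisfies $\Omega\ge\frac{V}{\lambda_{\rm e}e_{\rm unit}}+3\lambda_{\rm e}e^{\rm u}_{\max}+2(V+r_{\max})+B_{\min}$ and initially either $Q^{\rm U}_0=0$, or $B_0=\Omega$ and $Q^{\rm U}_0\le V+r_{\max}$. c) $Z$ is strongly stable and the power constraint holds. In particular there is an $[O(1/V),O(V)]$ rate–delay tradeoff: there is a constant $K$, independent of $V$, such that for every $V>0$ the average sensing rate in a) is at least $\bar R^*_{\rm P1}-K/V$ and the average lengths of both data queues in b) are at most $K(1+V)$. -/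

import Mathlib

open MeasureTheory ProbabilityTheory Filter Set

noncomputable section

namespace EdgeSensing

/-- Random event `ω_t = (a_t, e_t^h, h_t, ḡ_t, h̄_t)` of a slot. -/
abbrev Env : Type := Bool × ℝ × ℝ × ℝ × ℝ

namespace Env

/-- ON/OFF indicator of the primary link, as a real number in `{0, 1}`. -/
def a (w : Env) : ℝ := if w.1 then 1 else 0

/-- Harvested energy. -/
def eh (w : Env) : ℝ := w.2.1

/-- Channel gain between the wireless device and the edge server. -/
def h (w : Env) : ℝ := w.2.2.1

/-- Channel gain between the primary transmitter and the edge server. -/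
def g (w : Env) : ℝ := w.2.2.2.1

/-- Channel gain between the wireless device and the primary receiver. -/
def hbar (w : Env) : ℝ := w.2.2.2.2

end Env

/-- Control action `(r, p^u, f^u, f^s)` of a slot. -/
abbrev Action : Type := ℝ × ℝ × ℝ × ℝ

namespace Action

/-- Amount of sensed data. -/
def r (x : Action) : ℝ := x.1

/-- Transmit power of the device. -/
def p (x : Action) : ℝ := x.2.1

/-- Local CPU frequency. -/
def fu (x : Action) : ℝ := x.2.2.1

/-- Edge CPU frequency. -/
def fs (x : Action) : ℝ := x.2.2.2

end Action

/-- The constants of the system. -/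
structure Params where
  /-- slot length -/
  T : ℝ
  /-- bandwidth -/
  W : ℝ
  /-- `δp ^ 2` is the noise power spectral density at the primary receiver -/
  δp : ℝ
  /-- `δs ^ 2` is the noise power spectral density at the edge server -/
  δs : ℝ
  /-- interference threshold at the primary receiver -/
  Γth : ℝ
  /-- transmit power of the primary transmitter -/
  PB : ℝ
  /-- CPU cycles per bit -/
  C : ℝ
  /-- energy coefficient of local computing -/
  κc : ℝ
  /-- energy coefficient of edge computing -/
  κe : ℝ
  /-- sensing energy per bit -/
  eunit : ℝ
  rmax : ℝ
  pmax : ℝ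
  fumax : ℝ
  fsmax : ℝ
  /-- bound on the energy harvested in a slot -/
  Ehmax : ℝ
  /-- battery threshold below which the device must not spend energy -/
  Bmin : ℝ
  /-- battery capacity `Ω` -/
  cap : ℝ
  /-- scaling factor `λ_e` -/
  lamE : ℝ
  /-- scaling factor `λ_c` -/
  lamC : ℝ
  /-- average power budget of the edge server -/
  cth : ℝ

namespace Params

/-- Sign conditions on the physical constants; `noise_le` says that staying silent respects the
interference threshold. -/
structure Valid (P : Params) : Prop where
  T_pos : 0 < P.T
  W_pos : 0 < P.W
  δs_pos : 0 < P.δs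
  noise_le : P.W * P.δp ^ 2 ≤ P.Γth
  PB_nonneg : 0 ≤ P.PB
  C_pos : 0 < P.C
  κc_pos : 0 < P.κc
  κe_pos : 0 < P.κe
  eunit_pos : 0 < P.eunit
  rmax_nonneg : 0 ≤ P.rmax
  pmax_nonneg : 0 ≤ P.pmax
  fumax_nonneg : 0 ≤ P.fumax
  fsmax_nonneg : 0 ≤ P.fsmax
  Ehmax_nonneg : 0 ≤ P.Ehmax
  Bmin_nonneg : 0 ≤ P.Bmin
  cap_pos : 0 < P.cap
  lamE_pos : 0 < P.lamE
  lamC_pos : 0 < P.lamC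
  cth_nonneg : 0 ≤ P.cth

variable (P : Params)

/-- Signal-to-interference-plus-noise ratio `γ` at the edge server. -/
def sinr (w : Env) : ℝ := w.h / (w.a * P.PB * w.g + P.W * P.δs ^ 2)

/-- Offloaded data `l^off`. -/
def lOff (w : Env) (x : Action) : ℝ := P.W * P.T * Real.logb 2 (1 + x.p * P.sinr w)

/-- Locally processed data `l^loc`. -/
def lLoc (x : Action) : ℝ := x.fu * P.T / P.C

/-- Data processed at the edge server `l^edg`. -/
def lEdg (x : Action) : ℝ := x.fs * P.T / P.C

/-- Energy spent by the edge server `e^edg`. -/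
def eEdg (x : Action) : ℝ := P.κe * x.fs ^ 3 * P.T

/-- Energy spent by the device `e^u = e^col + e^off + e^loc`. -/
def eU (x : Action) : ℝ := P.eunit * x.r + x.p * P.T + P.κc * x.fu ^ 3 * P.T

/-- Largest offloaded data in a slot with event `w`. -/
def lOffMax (w : Env) : ℝ := P.W * P.T * Real.logb 2 (1 + P.pmax * P.sinr w)

def lLocMax : ℝ := P.fumax * P.T / P.C

def lEdgMax : ℝ := P.fsmax * P.T / P.C

def eEdgMax : ℝ := P.κe * P.fsmax ^ 3 * P.T

def eUMax : ℝ := P.eunit * P.rmax + P.pmax * P.T + P.κc * P.fumax ^ 3 * P.T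

/-- The constant `D` of the drift-plus-penalty bound. -/
def driftConst (μ : Measure Env) : ℝ :=
  (1 / 2) * ((P.lamC * P.eEdgMax) ^ 2 + (P.lamC * P.cth) ^ 2
    + (P.lamE * P.eUMax) ^ 2 + (P.lamE * P.Ehmax) ^ 2
    + (∫ w, (P.lOffMax w + P.lLocMax) ^ 2 ∂μ) + P.rmax ^ 2
    + P.lEdgMax ^ 2 + (∫ w, (P.lOffMax w) ^ 2 ∂μ))

/-- Interference constraint at the primary receiver. -/
def QoS (w : Env) (x : Action) : Prop :=
  w.a * (P.W * P.δp ^ 2 + x.p * w.hbar - P.Γth) ≤ 0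

/-- Box constraints on the control action. -/
def Box (x : Action) : Prop :=
  (0 ≤ x.r ∧ x.r ≤ P.rmax) ∧ (0 ≤ x.p ∧ x.p ≤ P.pmax) ∧
    (0 ≤ x.fu ∧ x.fu ≤ P.fumax) ∧ (0 ≤ x.fs ∧ x.fs ≤ P.fsmax)

end Params

/-- Requirements on the law `μ` of the random event of a slot. -/
structure EnvLaw (P : Params) (μ : Measure Env) : Prop where
  gains_nonneg : ∀ᵐ w ∂μ, 0 ≤ w.h ∧ 0 ≤ w.g ∧ 0 ≤ w.hbar
  harvest : ∀ᵐ w ∂μ, 0 ≤ w.eh ∧ w.eh ≤ P.Ehmax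
  lOffMax_memLp : MemLp P.lOffMax 2 μ

/-- Queue backlogs: data queues `Q^U`, `Q^S`, battery level `B`, virtual power-deficit queue `Z`. -/
structure Queues where
  QU : ℝ
  QS : ℝ
  B : ℝ
  Z : ℝ

/-- Admissible initial backlogs. -/
structure Queues.Valid (P : Params) (q : Queues) : Prop where
  QU_nonneg : 0 ≤ q.QU
  QS_nonneg : 0 ≤ q.QS
  B_nonneg : 0 ≤ q.B
  B_le : q.B ≤ P.cap
  Z_nonneg : 0 ≤ q.Z

/-- Update of the backlogs in a slot with event `w` and action `x`. -/
def Queues.next (P : Params) (q : Queues) (w : Env) (x : Action) : Queues where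
  QU := q.QU - P.lOff w x - P.lLoc x + x.r
  QS := q.QS - P.lEdg x + P.lOff w x
  B := min (q.B - P.lamE * P.eU x + P.lamE * w.eh) P.cap
  Z := max (q.Z + P.lamC * P.eEdg x - P.lamC * P.cth) 0

/-- Data causality at the device and at the edge server. -/
def DataCausal (P : Params) (q : Queues) (w : Env) (x : Action) : Prop :=
  (0 ≤ P.lOff w x + P.lLoc x ∧ P.lOff w x + P.lLoc x ≤ q.QU) ∧
    (0 ≤ P.lEdg x ∧ P.lEdg x ≤ q.QS)

/-- Energy causality: `0 ≤ λ_e e^u ≤ B · 1_{B ≥ Bmin}`. -/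
def EnergyCausal (P : Params) (q : Queues) (x : Action) : Prop :=
  0 ≤ P.lamE * P.eU x ∧
    P.lamE * P.eU x ≤ q.B * (if P.Bmin ≤ q.B then 1 else 0)

/-- Constraints of a single slot, without energy causality. -/
def SlotFeasible (P : Params) (q : Queues) (w : Env) (x : Action) : Prop :=
  P.QoS w x ∧ DataCausal P q w x ∧ P.Box x

/-- Objective of the per-slot problem, with weight `V`. -/
def slotObj (P : Params) (V : ℝ) (q : Queues) (w : Env) (x : Action) : ℝ :=
  V * x.r + q.Z * P.lamC * (P.cth - P.eEdg x)
    + P.lamE * (q.B - P.cap) * (P.eU x - w.eh)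
    + q.QU * (P.lOff w x + P.lLoc x - x.r)
    + q.QS * (P.lEdg x - P.lOff w x)

/-- A (randomized) online policy: the action of slot `t` is a measurable function of a random seed,
uniform on `[0, 1]`, and of the events of the slots `0, …, t`. -/
structure Policy where
  act : (t : ℕ) → unitInterval × (Fin (t + 1) → Env) → Action
  measurable_act : ∀ t, Measurable (act t)

/-- Sample space: the random seed and the sequence of events. -/
abbrev Sample : Type := unitInterval × (ℕ → Env)

/-- The seed is uniform and independent of the events, which are i.i.d. with law `μ`. -/
def sampleLaw (μ : Measure Env) [IsProbabilityMeasure μ] : Measure Sample :=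
  (volume : Measure unitInterval).prod (Measure.infinitePi fun _ : ℕ => μ)

/-- The event of slot `t`. -/
def event (t : ℕ) (s : Sample) : Env := s.2 t

/-- The action of slot `t` under the policy `π`. -/
def Policy.action (π : Policy) (t : ℕ) (s : Sample) : Action :=
  π.act t (s.1, fun i => s.2 i)

/-- The backlogs at the start of slot `t` under the policy `π`, from initial backlogs `q₀`. -/
def Policy.queues (P : Params) (q₀ : Queues) (π : Policy) : ℕ → Sample → Queues
  | 0, _ => q₀
  | t + 1, s => (Policy.queues P q₀ π t s).next P (event t s) (π.action t s)

/-- The upper limit of the averages `(1 / N) ∑_{t < N} u t`, as an extended real number. -/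
def limsupAvg (u : ℕ → ℝ) : EReal :=
  limsup (fun N : ℕ => (((∑ t ∈ Finset.range N, u t) / N : ℝ) : EReal)) atTop

/-- The lower limit of the averages `(1 / N) ∑_{t < N} u t`, as an extended real number. -/
def liminfAvg (u : ℕ → ℝ) : EReal :=
  liminf (fun N : ℕ => (((∑ t ∈ Finset.range N, u t) / N : ℝ) : EReal)) atTop

/-- Strong stability of a process: `limsup (1 / N) ∑_{t < N} E|X_t| < ∞`. -/
def StronglyStable {S : Type*} [MeasurableSpace S] (ν : Measure S) (X : ℕ → S → ℝ) : Prop :=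
  (∀ t, Integrable (X t) ν) ∧ limsupAvg (fun t => ∫ s, |X t s| ∂ν) < ⊤

section Problems

variable (P : Params) (μ : Measure Env) [IsProbabilityMeasure μ] (q₀ : Queues)

/-- Expected sensed data `E[r_t]`. -/
def meanRate (π : Policy) (t : ℕ) : ℝ := ∫ s, (π.action t s).r ∂sampleLaw μ

/-- Expected backlog `E[Q_t^U]`. -/
def meanQU (π : Policy) (t : ℕ) : ℝ := ∫ s, (π.queues P q₀ t s).QU ∂sampleLaw μ

/-- Expected backlog `E[Q_t^S]`. -/
def meanQS (π : Policy) (t : ℕ) : ℝ := ∫ s, (π.queues P q₀ t s).QS ∂sampleLaw μ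

/-- Expected energy of the edge server `E[e_t^edg]`. -/
def meanEdg (π : Policy) (t : ℕ) : ℝ := ∫ s, P.eEdg (π.action t s) ∂sampleLaw μ

/-- Both data queues are strongly stable. -/
def DataStable (π : Policy) : Prop :=
  StronglyStable (sampleLaw μ) (fun t s => (π.queues P q₀ t s).QU) ∧
    StronglyStable (sampleLaw μ) (fun t s => (π.queues P q₀ t s).QS)

/-- The long-term average power constraint of the edge server. -/
def PowerBudget (π : Policy) : Prop := limsupAvg (meanEdg P μ π) ≤ (P.cth : EReal)

/-- Energy causality holds in every slot, almost surely. -/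
def AlwaysEnergyCausal (π : Policy) : Prop :=
  ∀ t, ∀ᵐ s ∂sampleLaw μ, EnergyCausal P (π.queues P q₀ t s) (π.action t s)

/-- The constraints shared by the two problems below. -/
def CommonFeasible (π : Policy) : Prop :=
  (∀ t, ∀ᵐ s ∂sampleLaw μ,
    SlotFeasible P (π.queues P q₀ t s) (event t s) (π.action t s)) ∧
  DataStable P μ q₀ π ∧ PowerBudget P μ π

/-- Feasibility for (P1). -/
def FeasibleP1 (π : Policy) : Prop :=
  CommonFeasible P μ q₀ π ∧ AlwaysEnergyCausal P μ q₀ π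

/-- Feasibility for (P2): energy causality is relaxed to a long-term average constraint. -/
def FeasibleP2 (π : Policy) : Prop :=
  CommonFeasible P μ q₀ π ∧
    limsupAvg (fun t => ∫ s, (P.eU (π.action t s) - (event t s).eh) ∂sampleLaw μ) ≤ 0

/-- Optimal value of (P1): the supremum of the long-term average sensing rate. -/
def optP1 : ℝ := sSup {v : ℝ | ∃ π, FeasibleP1 P μ q₀ π ∧ limsupAvg (meanRate μ π) = (v : EReal)}

/-- Optimal value of (P2). -/
def optP2 : ℝ := sSup {v : ℝ | ∃ π, FeasibleP2 P μ q₀ π ∧ limsupAvg (meanRate μ π) = (v : EReal)}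

/-- `π` is a run of PLySE with weight `V`: in every slot its action solves the per-slot problem
for the current backlogs and the current event. -/
def IsPLySE (V : ℝ) (π : Policy) : Prop :=
  ∀ t, ∀ᵐ s ∂sampleLaw μ,
    SlotFeasible P (π.queues P q₀ t s) (event t s) (π.action t s) ∧
    IsMaxOn (slotObj P V (π.queues P q₀ t s) (event t s))
      {x | SlotFeasible P (π.queues P q₀ t s) (event t s) x} (π.action t s)

end Problems

/-- Slater condition with slack `ε`: the randomized `ω`-only policy `Γ` (a Markov kernel from events
to actions, which does not see the backlogs) has mean sensing rate `φ` and meets the long-term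
requirements with slack `ε`. -/
structure Slater (P : Params) (μ : Measure Env) (ε φ : ℝ) (Γ : Kernel Env Action) : Prop where
  ε_pos : 0 < ε
  admissible : ∀ᵐ y ∂(μ ⊗ₘ Γ), P.QoS y.1 y.2 ∧ P.Box y.2
  rate : ∫ y, y.2.r ∂(μ ⊗ₘ Γ) = φ
  edge : ∫ y, P.eEdg y.2 ∂(μ ⊗ₘ Γ) ≤ P.cth - ε
  energy : ∫ y, (P.eU y.2 - y.1.eh) ∂(μ ⊗ₘ Γ) ≤ -ε
  offload : ∫ y, P.lOff y.1 y.2 ∂(μ ⊗ₘ Γ) ≤ (∫ y, P.lEdg y.2 ∂(μ ⊗ₘ Γ)) - ε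
  sensing : ∫ y, y.2.r ∂(μ ⊗ₘ Γ) ≤ (∫ y, (P.lOff y.1 y.2 + P.lLoc y.2) ∂(μ ⊗ₘ Γ)) - ε

end EdgeSensing

end

namespace EdgeSensing

/-! The proof is a drift-plus-penalty argument for the quadratic Lyapunov function `lyapunov` of the
two data queues, the energy deficit `P.cap - B` and `Z`. Up to a second-order term of mean
`driftConst`, the drift minus `V * r` equals minus the per-slot objective, and PLySE maximizes that
objective.

Two obstacles separate this from the textbook argument. The competitor's action need not respect
data causality for the backlogs of PLySE. `exists_slotFeasible` cuts it down, and
`half_sq_add_excess_le` shows that the loss fits into the second-order budget, so `D` does not grow.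
Moreover the competitor is an arbitrary history-dependent policy. Only the joint law of its event
and action in a slot `τ` matters: by resampling the event of slot `t`, `meanLyapunov_drift_le`
compares PLySE in slot `t` with any such law, drawn independently of the backlogs. Averaging over
`τ` then replaces the usual reduction to stationary policies. The long-term constraints control two
of the terms, and the data-queue terms telescope to `E[Q_M] / M`, which vanishes because a strongly
stable queue with increments bounded above in mean grows sublinearly
(`eventually_le_mul_of_avg_bounded`).

Against a policy feasible for (P2) this gives a), since (P1) is more restrictive than (P2). Against
the Slater policy it gives a drift of `-ε` per unit of backlog, hence stability and the power
constraint; PLySE is then itself feasible for (P2), so its own rate is at most `optP2`, which yields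
b). Energy causality for a large battery is pathwise: the potential `P.cap - B + QU ^ 2 / X₁` does
not increase while the deficit exceeds the threshold `X₁` (`energyReserve_step`). -/

/-- The channel gains and the harvested energy of an event lie in their ranges. -/
def Env.Regular (P : Params) (w : Env) : Prop :=
  (0 ≤ w.h ∧ 0 ≤ w.g ∧ 0 ≤ w.hbar) ∧ (0 ≤ w.eh ∧ w.eh ≤ P.Ehmax)

lemma Env.a_nonneg (w : Env) : 0 ≤ w.a := by
  unfold Env.a; split_ifs <;> norm_num

/-! ### Pathwise bounds in a single slot -/

section Model

variable {P : Params}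

lemma sinr_nonneg (hP : P.Valid) {w : Env} (hw : w.Regular P) : 0 ≤ P.sinr w := by
  have h1 := hP.PB_nonneg
  have h2 := hP.W_pos
  have h3 := w.a_nonneg
  obtain ⟨⟨h4, h5, h6⟩, -⟩ := hw
  unfold Params.sinr
  positivity

lemma lOff_mono (hP : P.Valid) {w : Env} (hw : w.Regular P) {x y : Action}
    (hx : 0 ≤ x.p) (hxy : x.p ≤ y.p) : P.lOff w x ≤ P.lOff w y := by
  have h1 := hP.W_pos
  have h2 := hP.T_pos
  have h3 := sinr_nonneg hP hw
  unfold Params.lOff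
  refine mul_le_mul_of_nonneg_left ?_ (by positivity)
  exact Real.logb_le_logb_of_le (by norm_num) (by positivity) (by gcongr)

lemma lOff_nonneg (hP : P.Valid) {w : Env} (hw : w.Regular P) {x : Action}
    (hx : 0 ≤ x.p) : 0 ≤ P.lOff w x := by
  have := lOff_mono hP hw (x := (0, 0, 0, 0)) (y := x) le_rfl hx
  simpa [Params.lOff, Action.p] using this

lemma lOff_le_lOffMax (hP : P.Valid) {w : Env} (hw : w.Regular P) {x : Action}
    (hx : P.Box x) : P.lOff w x ≤ P.lOffMax w :=
  lOff_mono hP hw (y := (0, P.pmax, 0, 0)) hx.2.1.1 hx.2.1.2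

lemma lLoc_nonneg (hP : P.Valid) {x : Action} (hx : P.Box x) : 0 ≤ P.lLoc x := by
  have h1 := hP.T_pos
  have h2 := hP.C_pos
  have h3 := hx.2.2.1.1
  unfold Params.lLoc
  positivity

lemma lLoc_le_lLocMax (hP : P.Valid) {x : Action} (hx : P.Box x) : P.lLoc x ≤ P.lLocMax := by
  have h1 := hP.T_pos
  have h2 := hP.C_pos
  have h3 := hx.2.2.1.2
  unfold Params.lLoc Params.lLocMax
  gcongr

lemma lEdg_nonneg (hP : P.Valid) {x : Action} (hx : P.Box x) : 0 ≤ P.lEdg x := by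
  have h1 := hP.T_pos
  have h2 := hP.C_pos
  have h3 := hx.2.2.2.1
  unfold Params.lEdg
  positivity

lemma lEdg_le_lEdgMax (hP : P.Valid) {x : Action} (hx : P.Box x) : P.lEdg x ≤ P.lEdgMax := by
  have h1 := hP.T_pos
  have h2 := hP.C_pos
  have h3 := hx.2.2.2.2
  unfold Params.lEdg Params.lEdgMax
  gcongr

lemma eEdg_nonneg (hP : P.Valid) {x : Action} (hx : P.Box x) : 0 ≤ P.eEdg x := by
  have h1 := hP.T_pos
  have h2 := hP.κe_pos
  have h3 := hx.2.2.2.1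
  unfold Params.eEdg
  positivity

lemma eEdg_le_eEdgMax (hP : P.Valid) {x : Action} (hx : P.Box x) : P.eEdg x ≤ P.eEdgMax := by
  have h1 := hP.T_pos
  have h2 := hP.κe_pos
  have h3 := hx.2.2.2.1
  have h4 := hx.2.2.2.2
  unfold Params.eEdg Params.eEdgMax
  gcongr

lemma eU_nonneg (hP : P.Valid) {x : Action} (hx : P.Box x) : 0 ≤ P.eU x := by
  have h1 := hP.T_pos
  have h2 := hP.κc_pos
  have h3 := hP.eunit_pos
  obtain ⟨⟨h4, -⟩, ⟨h5, -⟩, ⟨h6, -⟩, -⟩ := hx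
  unfold Params.eU
  positivity

lemma eU_le_eUMax (hP : P.Valid) {x : Action} (hx : P.Box x) : P.eU x ≤ P.eUMax := by
  have h1 := hP.T_pos
  have h2 := hP.κc_pos
  have h3 := hP.eunit_pos
  obtain ⟨⟨h4, h4'⟩, ⟨h5, h5'⟩, ⟨h6, h6'⟩, -⟩ := hx
  unfold Params.eU Params.eUMax
  gcongr

/-- Backlogs that are nonnegative, with a battery level below its capacity. -/
structure Queues.Proper (P : Params) (q : Queues) : Prop where
  QU_nonneg : 0 ≤ q.QU
  QS_nonneg : 0 ≤ q.QS
  B_le : q.B ≤ P.cap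
  Z_nonneg : 0 ≤ q.Z

/-- Nonnegativity of the battery level is deliberately lost: PLySE does not enforce energy causality
and may overdraw the battery. -/
lemma Queues.Valid.proper {q : Queues} (hq : q.Valid P) : q.Proper P :=
  ⟨hq.QU_nonneg, hq.QS_nonneg, hq.B_le, hq.Z_nonneg⟩

lemma SlotFeasible.proper_next (hP : P.Valid) {q : Queues} {w : Env}
    (hw : w.Regular P) {x : Action} (hx : SlotFeasible P q w x) : (q.next P w x).Proper P := by
  obtain ⟨-, ⟨⟨h1, h2⟩, h3, h4⟩, hb⟩ := hx
  have h5 := lOff_nonneg hP hw hb.2.1.1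
  have h6 := hb.1.1
  refine ⟨?_, ?_, min_le_right _ _, le_max_right _ _⟩
  · simp only [Queues.next]; linarith
  · simp only [Queues.next]; linarith

/-- Transmit power and local computing can be scaled down so that the data leaving the device
equals any smaller nonnegative amount. -/
lemma exists_scale (hP : P.Valid) {w : Env} (hw : w.Regular P) {x : Action} (hx : P.Box x)
    {c : ℝ} (hc : 0 ≤ c) (hc' : c ≤ P.lOff w x + P.lLoc x) :
    ∃ s ∈ Icc (0 : ℝ) 1,
      P.lOff w (x.r, s * x.p, s * x.fu, x.fs) + P.lLoc (x.r, s * x.p, s * x.fu, x.fs) = c := by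
  have hγ := sinr_nonneg hP hw
  have hp := hx.2.1.1
  have hcont : ContinuousOn (fun s : ℝ => P.lOff w (x.r, s * x.p, s * x.fu, x.fs)
      + P.lLoc (x.r, s * x.p, s * x.fu, x.fs)) (Icc 0 1) := by
    simp only [Params.lOff, Params.lLoc, Action.p, Action.fu, Real.logb]
    refine ContinuousOn.add (continuousOn_const.mul (ContinuousOn.div_const ?_ _))
      (by fun_prop)
    refine ContinuousOn.log (by fun_prop) fun s hs => ?_
    have : 0 ≤ s * x.p * P.sinr w := mul_nonneg (mul_nonneg hs.1 hp) hγ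
    have h2 : x.p = x.2.1 := rfl
    rw [← h2]
    linarith
  have := intermediate_value_Icc (zero_le_one) hcont
  refine this ⟨?_, ?_⟩
  · simpa [Params.lOff, Params.lLoc, Action.p, Action.fu] using hc
  · simpa [Params.lOff, Params.lLoc, Action.p, Action.fu] using hc'

/-- Any action meeting the box and interference constraints can be cut down to one that respects
data causality, at a controlled loss in the per-slot objective. -/
lemma exists_slotFeasible (hP : P.Valid) {q : Queues} (hq : q.Proper P) {w : Env}
    (hw : w.Regular P) {x : Action} (hx : P.Box x) (hx' : P.QoS w x) (V : ℝ) :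
    ∃ y, SlotFeasible P q w y ∧
      slotObj P V q w x ≤ slotObj P V q w y
        + q.QU * (P.lOff w x + P.lLoc x - min (P.lOff w x + P.lLoc x) q.QU)
        + q.QS * (P.lEdg x - min (P.lEdg x) q.QS) := by
  have hT := hP.T_pos
  have hC := hP.C_pos
  have hκ := hP.κc_pos
  have hκe := hP.κe_pos
  have hoff := lOff_nonneg hP hw hx.2.1.1
  have hloc := lLoc_nonneg hP hx
  have hedg := lEdg_nonneg hP hx
  have hp := hx.2.1.1
  have hfu := hx.2.2.1.1
  have hfs := hx.2.2.2.1
  obtain ⟨s, ⟨hs0, hs1⟩, hs⟩ := exists_scale hP hw hx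
    (le_min (add_nonneg hoff hloc) hq.QU_nonneg) (min_le_left _ q.QU)
  obtain ⟨f, hf0, hf1, hf⟩ : ∃ f, 0 ≤ f ∧ f ≤ x.fs ∧ f * P.T / P.C = min (P.lEdg x) q.QS := by
    rcases le_total (P.lEdg x) q.QS with h | h
    · exact ⟨x.fs, hfs, le_rfl, by rw [min_eq_left h]; rfl⟩
    · refine ⟨q.QS * P.C / P.T, by have := hq.QS_nonneg; positivity, ?_, ?_⟩
      · rw [div_le_iff₀ hT]
        have : q.QS ≤ x.fs * P.T / P.C := h
        rwa [le_div_iff₀ hC] at this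
      · rw [min_eq_right h]; field_simp
  have hsp : s * x.p ≤ x.p := mul_le_of_le_one_left hp hs1
  have hsp0 : 0 ≤ s * x.p := mul_nonneg hs0 hp
  have hsf : s * x.fu ≤ x.fu := mul_le_of_le_one_left hfu hs1
  have hsf0 : 0 ≤ s * x.fu := mul_nonneg hs0 hfu
  have hbox : P.Box (x.r, s * x.p, s * x.fu, f) :=
    ⟨hx.1, ⟨hsp0, hsp.trans hx.2.1.2⟩, ⟨hsf0, hsf.trans hx.2.2.1.2⟩, ⟨hf0, hf1.trans hx.2.2.2.2⟩⟩
  have hs' : P.lOff w (x.r, s * x.p, s * x.fu, f) + P.lLoc (x.r, s * x.p, s * x.fu, f)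
      = min (P.lOff w x + P.lLoc x) q.QU := hs
  have hf' : P.lEdg (x.r, s * x.p, s * x.fu, f) = min (P.lEdg x) q.QS := hf
  refine ⟨(x.r, s * x.p, s * x.fu, f), ⟨?_, ⟨⟨?_, ?_⟩, ?_, ?_⟩, hbox⟩, ?_⟩
  · unfold Params.QoS at hx' ⊢
    refine le_trans (mul_le_mul_of_nonneg_left ?_ w.a_nonneg) hx'
    have := mul_le_mul_of_nonneg_right hsp hw.1.2.2
    simp only [Action.p] at *
    linarith
  · exact add_nonneg (lOff_nonneg hP hw hsp0) (lLoc_nonneg hP hbox)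
  · rw [hs']; exact min_le_right _ _
  · exact lEdg_nonneg hP hbox
  · rw [hf']; exact min_le_right _ _
  · have h1 : P.lOff w (x.r, s * x.p, s * x.fu, f) ≤ P.lOff w x := lOff_mono hP hw hsp0 hsp
    have h2 : P.eU (x.r, s * x.p, s * x.fu, f) ≤ P.eU x := by
      have h3 : P.eU x = P.eunit * x.r + x.p * P.T + P.κc * x.fu ^ 3 * P.T := rfl
      rw [h3]
      change P.eunit * x.r + (s * x.p) * P.T + P.κc * (s * x.fu) ^ 3 * P.T ≤ _
      gcongr
    have h3 : P.eEdg (x.r, s * x.p, s * x.fu, f) ≤ P.eEdg x := by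
      have h3 : P.eEdg x = P.κe * x.fs ^ 3 * P.T := rfl
      rw [h3]
      change P.κe * f ^ 3 * P.T ≤ _
      gcongr
    have h4 : Action.r (x.r, s * x.p, s * x.fu, f) = x.r := rfl
    -- The cut only helps in all the other terms: less offloading relieves `QS`, and both energies
    -- carry nonpositive weights in the objective.
    have e1 := mul_le_mul_of_nonneg_left h1 hq.QS_nonneg
    have e2 := mul_le_mul_of_nonneg_left h2
      (mul_nonneg hP.lamE_pos.le (sub_nonneg.2 hq.B_le))
    have e3 := mul_le_mul_of_nonneg_left h3 (mul_nonneg hq.Z_nonneg hP.lamC_pos.le)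
    unfold slotObj
    rw [hs', hf', h4]
    linarith

/-! ### Drift-plus-penalty bound -/

/-- Quadratic Lyapunov function of the backlogs. -/
noncomputable def lyapunov (P : Params) (q : Queues) : ℝ :=
  (q.QU ^ 2 + q.QS ^ 2 + (P.cap - q.B) ^ 2 + q.Z ^ 2) / 2

lemma lyapunov_nonneg (P : Params) (q : Queues) : 0 ≤ lyapunov P q := by
  unfold lyapunov; positivity

/-- The drift bound in a slot with event `w`; its mean is `Params.driftConst`. -/
noncomputable def slotDrift (P : Params) (w : Env) : ℝ :=
  (1 / 2) * ((P.lamC * P.eEdgMax) ^ 2 + (P.lamC * P.cth) ^ 2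
    + (P.lamE * P.eUMax) ^ 2 + (P.lamE * P.Ehmax) ^ 2
    + (P.lOffMax w + P.lLocMax) ^ 2 + P.rmax ^ 2
    + P.lEdgMax ^ 2 + (P.lOffMax w) ^ 2)

/-- Here `b` is what PLySE removes from the queue and `c` what the competitor would like to remove.
If `c` exceeds `Q`, then `b ≤ Q` and `Q ^ 2 / 2 + Q * (c - Q) = c ^ 2 / 2 - (c - Q) ^ 2 / 2`. So the
squared departures and the loss from cutting the competitor share a single budget `m ^ 2 / 2`. -/
lemma half_sq_add_excess_le {Q b c m : ℝ} (hQ : 0 ≤ Q) (hb0 : 0 ≤ b) (hb : b ≤ Q) (hbm : b ≤ m)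
    (hc : 0 ≤ c) (hcm : c ≤ m) : b ^ 2 / 2 + Q * (c - min c Q) ≤ m ^ 2 / 2 := by
  rcases le_total c Q with h | h
  · rw [min_eq_left h]; nlinarith
  · rw [min_eq_right h]; nlinarith [sq_nonneg (c - Q)]

lemma sq_sub_le_sq_add_sq {a b A B : ℝ} (ha : 0 ≤ a) (hb : 0 ≤ b) (haA : a ≤ A) (hbB : b ≤ B) :
    (a - b) ^ 2 ≤ A ^ 2 + B ^ 2 := by
  nlinarith [mul_nonneg ha hb]

lemma sq_max_zero_le (a : ℝ) : (max a 0) ^ 2 ≤ a ^ 2 := by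
  rcases le_total a 0 with h | h
  · rw [max_eq_right h]; nlinarith
  · rw [max_eq_left h]

/-- Drift-plus-penalty bound of a slot: the action of PLySE does, up to `slotDrift`, at least as
well as any action meeting the box and interference constraints, data-causal or not. -/
lemma lyapunov_next_le (hP : P.Valid) {q : Queues} (hq : q.Proper P) {w : Env}
    (hw : w.Regular P) {V : ℝ} {x y : Action} (hx : SlotFeasible P q w x)
    (hmax : IsMaxOn (slotObj P V q w) {x | SlotFeasible P q w x} x)
    (hy : P.Box y) (hy' : P.QoS w y) :
    lyapunov P (q.next P w x) - lyapunov P q - V * x.r ≤ slotDrift P w - slotObj P V q w y := by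
  obtain ⟨z, hz, hyz⟩ := exists_slotFeasible hP hq hw hy hy' V
  have hzx : slotObj P V q w z ≤ slotObj P V q w x := hmax hz
  obtain ⟨-, ⟨⟨b0, b1⟩, c0, c1⟩, hb⟩ := hx
  have hoff := lOff_nonneg hP hw hb.2.1.1
  have hoff' := lOff_le_lOffMax hP hw hb
  have hle := hP.lamE_pos.le
  have hlc := hP.lamC_pos.le
  have k1 := half_sq_add_excess_le hq.QU_nonneg b0 b1
    (add_le_add hoff' (lLoc_le_lLocMax hP hb))
    (add_nonneg (lOff_nonneg hP hw hy.2.1.1) (lLoc_nonneg hP hy))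
    (add_le_add (lOff_le_lOffMax hP hw hy) (lLoc_le_lLocMax hP hy))
  have k2 := half_sq_add_excess_le hq.QS_nonneg c0 c1 (lEdg_le_lEdgMax hP hb)
    (lEdg_nonneg hP hy) (lEdg_le_lEdgMax hP hy)
  have k3 : P.lOff w x ^ 2 ≤ P.lOffMax w ^ 2 := pow_le_pow_left₀ hoff hoff' 2
  have k4 : x.r ^ 2 ≤ P.rmax ^ 2 := pow_le_pow_left₀ hb.1.1 hb.1.2 2
  have k5 := sq_sub_le_sq_add_sq (mul_nonneg hle (eU_nonneg hP hb)) (mul_nonneg hle hw.2.1)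
    (mul_le_mul_of_nonneg_left (eU_le_eUMax hP hb) hle) (mul_le_mul_of_nonneg_left hw.2.2 hle)
  have k6 := sq_sub_le_sq_add_sq (mul_nonneg hlc (eEdg_nonneg hP hb))
    (mul_nonneg hlc hP.cth_nonneg)
    (mul_le_mul_of_nonneg_left (eEdg_le_eEdgMax hP hb) hlc) le_rfl
  have k7 := sq_max_zero_le (q.Z + P.lamC * P.eEdg x - P.lamC * P.cth)
  -- The deficit evolves as a reflected queue, like `Z`: capping the battery is truncating its
  -- deficit at zero.
  have k8 : (P.cap - min (q.B - P.lamE * P.eU x + P.lamE * w.eh) P.cap) ^ 2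
      ≤ (P.cap - (q.B - P.lamE * P.eU x + P.lamE * w.eh)) ^ 2 := by
    have := sq_max_zero_le (P.cap - (q.B - P.lamE * P.eU x + P.lamE * w.eh))
    rwa [← sub_self P.cap, max_sub_sub_left] at this
  -- Arrivals and departures of a data queue have the same sign, so the cross terms in the squared
  -- increments can be dropped.
  have k9 : 0 ≤ (P.lOff w x + P.lLoc x) * x.r := mul_nonneg b0 hb.1.1
  have k10 : 0 ≤ P.lEdg x * P.lOff w x := mul_nonneg c0 hoff
  unfold slotObj at hzx hyz ⊢
  unfold lyapunov slotDrift Queues.next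
  simp only
  linarith

/-! ### Energy causality for a large battery -/

/-- PLySE senses only if the backlog and the energy deficit are small. -/
lemma sensing_gain_nonneg (hP : P.Valid) {q : Queues} {w : Env}
    {V : ℝ} {x : Action} (hx : SlotFeasible P q w x)
    (hmax : IsMaxOn (slotObj P V q w) {x | SlotFeasible P q w x} x) :
    0 ≤ x.r * (V - q.QU - P.lamE * P.eunit * (P.cap - q.B)) := by
  -- Data causality does not involve `r`, so not sensing is always a feasible alternative; the
  -- objective is affine in `r`.
  have hz : SlotFeasible P q w (0, x.p, x.fu, x.fs) :=
    ⟨hx.1, hx.2.1, ⟨le_rfl, hP.rmax_nonneg⟩, hx.2.2.2⟩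
  have hle : slotObj P V q w (0, x.p, x.fu, x.fs) ≤ slotObj P V q w x := hmax hz
  have h1 : P.eU (0, x.p, x.fu, x.fs) = P.eU x - P.eunit * x.r := by
    simp only [Params.eU, Action.r, Action.p, Action.fu]
    ring
  have h2 : P.eEdg (0, x.p, x.fu, x.fs) = P.eEdg x := rfl
  have h3 : P.lEdg (0, x.p, x.fu, x.fs) = P.lEdg x := rfl
  have h4 : P.lOff w (0, x.p, x.fu, x.fs) = P.lOff w x := rfl
  have h5 : P.lLoc (0, x.p, x.fu, x.fs) = P.lLoc x := rfl
  have h6 : Action.r (0, x.p, x.fu, x.fs) = 0 := rfl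
  unfold slotObj at hle
  rw [h1, h2, h3, h4, h5, h6] at hle
  linarith

/-- The energy that PLySE spends on offloading and local computing is paid for by the data
leaving the device. -/
lemma energy_le_departures (hP : P.Valid) {q : Queues} (hq : q.Proper P) {w : Env}
    (hw : w.Regular P) {V : ℝ} {x : Action} (hx : SlotFeasible P q w x)
    (hmax : IsMaxOn (slotObj P V q w) {x | SlotFeasible P q w x} x) :
    (P.cap - q.B) * (P.lamE * (P.eU x - P.eunit * x.r)) ≤ q.QU * (P.lOff w x + P.lLoc x) := by
  have hz0 : P.lOff w (x.r, 0, 0, x.fs) = 0 := by simp [Params.lOff, Action.p]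
  have hz1 : P.lLoc (x.r, 0, 0, x.fs) = 0 := by simp [Params.lLoc, Action.fu]
  -- The alternative is to keep sensing but send and compute nothing at the device; `noise_le` makes
  -- silence acceptable to the primary link.
  have hz : SlotFeasible P q w (x.r, 0, 0, x.fs) := by
    refine ⟨?_, ⟨?_, hx.2.1.2⟩,
      ⟨hx.2.2.1, ⟨le_rfl, hP.pmax_nonneg⟩, ⟨le_rfl, hP.fumax_nonneg⟩, hx.2.2.2.2.2⟩⟩
    · refine mul_nonpos_of_nonneg_of_nonpos w.a_nonneg ?_
      have := hP.noise_le
      simp only [Action.p]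
      linarith
    · rw [hz0, hz1]; simpa using hq.QU_nonneg
  have hle : slotObj P V q w (x.r, 0, 0, x.fs) ≤ slotObj P V q w x := hmax hz
  have h1 : P.eU (x.r, 0, 0, x.fs) = P.eunit * x.r := by
    simp [Params.eU, Action.r, Action.p, Action.fu]
  have h2 : P.eEdg (x.r, 0, 0, x.fs) = P.eEdg x := rfl
  have h3 : P.lEdg (x.r, 0, 0, x.fs) = P.lEdg x := rfl
  have h6 : Action.r (x.r, 0, 0, x.fs) = x.r := rfl
  have h7 := mul_nonneg hq.QS_nonneg (lOff_nonneg hP hw hx.2.2.2.1.1)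
  unfold slotObj at hle
  rw [h1, h2, h3, hz0, hz1, h6] at hle
  linarith

/-- Energy deficit above which PLySE does not sense. -/
noncomputable def deficitThreshold (P : Params) (V : ℝ) : ℝ :=
  V / (P.lamE * P.eunit) + (V + P.rmax)

/-- Invariant of PLySE for a large battery: either the device is empty, or the energy deficit is
small, or the energy needed to empty the device is available. -/
structure EnergyReserve (P : Params) (V : ℝ) (q : Queues) : Prop where
  QU_le : q.QU ≤ V + P.rmax
  B_nonneg : 0 ≤ q.B
  reserve : q.QU = 0 ∨ P.cap - q.B ≤ deficitThreshold P V ∨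
    P.cap - q.B + q.QU ^ 2 / deficitThreshold P V ≤
      deficitThreshold P V + P.lamE * P.eUMax + (V + P.rmax) ^ 2 / deficitThreshold P V

/-- Below the threshold `X₁` the battery is ample, and one slot costs at most `P.lamE * P.eUMax`.
Above it nothing is sensed, and the spent energy is at most `QU / X₁` times the departing data,
which is covered by the decrease of `QU ^ 2 / X₁`. An empty device with a deficit above `X₁` stays
empty and spends nothing, which allows an arbitrary initial charge. -/
lemma energyReserve_step (hP : P.Valid) {q : Queues} (hq : q.Proper P) {w : Env}
    (hw : w.Regular P) {V : ℝ} (hV : 0 < V) {x : Action} (hx : SlotFeasible P q w x)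
    (hmax : IsMaxOn (slotObj P V q w) {x | SlotFeasible P q w x} x)
    (hcap : V / (P.lamE * P.eunit) + 3 * P.lamE * P.eUMax + 2 * (V + P.rmax) + P.Bmin ≤ P.cap)
    (hres : EnergyReserve P V q) :
    EnergyCausal P q x ∧ EnergyReserve P V (q.next P w x) := by
  obtain ⟨hQU, hB, hr⟩ := hres
  have hsens := sensing_gain_nonneg hP hx hmax
  have hen := energy_le_departures hP hq hw hx hmax
  obtain ⟨-, ⟨⟨b0, b1⟩, -⟩, hb⟩ := hx
  have hle := hP.lamE_pos
  have heu := hP.eunit_pos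
  have hrm := hP.rmax_nonneg
  have hr0 := hb.1.1
  have hr1 := hb.1.2
  have hU0 := mul_nonneg hle.le (eU_nonneg hP hb)
  have hU1 := mul_le_mul_of_nonneg_left (eU_le_eUMax hP hb) hle.le
  have hU2 := hU0.trans hU1
  have heh := mul_nonneg hle.le hw.2.1
  have hBle := hq.B_le
  have hQ0 := hq.QU_nonneg
  have hBm := hP.Bmin_nonneg
  set b := P.lOff w x + P.lLoc x with hbdef
  set X₁ := deficitThreshold P V with hX₁
  set K := V + P.rmax with hK
  have hVdiv : 0 < V / (P.lamE * P.eunit) := by positivity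
  have hKpos : 0 < K := by linarith
  have hX₁K : K ≤ X₁ := by rw [hX₁, deficitThreshold]; linarith
  have hX₁pos : 0 < X₁ := by linarith
  -- The summand `K` in the threshold serves this purpose: emptying a backlog of at most `K` then
  -- costs at most `K` in energy.
  have hKX : K ^ 2 / X₁ ≤ K := by rw [div_le_iff₀ hX₁pos]; nlinarith
  have hQX : 0 ≤ q.QU ^ 2 / X₁ := by positivity
  have hX₁def : X₁ = V / (P.lamE * P.eunit) + K := rfl
  have hBnext : P.cap - (q.next P w x).B ≤ max (P.cap - q.B + P.lamE * P.eU x) 0 := by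
    have : P.cap - (q.next P w x).B
        = max (P.cap - (q.B - P.lamE * P.eU x + P.lamE * w.eh)) (P.cap - P.cap) := by
      rw [max_sub_sub_left]; rfl
    rw [this, sub_self]
    exact max_le_max (by linarith) le_rfl
  have hBnext' : P.cap - (q.next P w x).B ≤ P.cap - q.B + P.lamE * P.eU x := by
    rwa [max_eq_left (by linarith)] at hBnext
  have hQnext : (q.next P w x).QU = q.QU - b + x.r := by
    simp only [Queues.next, hbdef]; ring
  have hQnext0 : 0 ≤ (q.next P w x).QU := by rw [hQnext]; linarith
  have hQbound : (q.next P w x).QU ≤ K := by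
    rw [hQnext]
    -- Sensing requires a backlog of at most `V`, and a slot then adds at most `rmax`.
    rcases hr0.eq_or_lt with h | h
    · linarith
    · have h2 := nonneg_of_mul_nonneg_right hsens h
      have h3 : 0 ≤ P.lamE * P.eunit * (P.cap - q.B) := by
        have : 0 ≤ P.cap - q.B := by linarith
        positivity
      linarith
  have hr_zero : X₁ < P.cap - q.B → x.r = 0 := by
    intro h
    by_contra hne
    have h2 := nonneg_of_mul_nonneg_right hsens (lt_of_le_of_ne hr0 (Ne.symm hne))
    have h3 : V / (P.lamE * P.eunit) < P.cap - q.B := by linarith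
    rw [div_lt_iff₀ (by positivity)] at h3
    linarith
  have high : P.Bmin + P.lamE * P.eUMax ≤ q.B → EnergyCausal P q x := by
    intro h
    refine ⟨hU0, ?_⟩
    rw [if_pos (by linarith)]
    linarith
  by_cases hlow : P.cap - q.B ≤ X₁
  · refine ⟨high (by linarith), hQbound, by linarith, Or.inr (Or.inr ?_)⟩
    have : (q.next P w x).QU ^ 2 / X₁ ≤ K ^ 2 / X₁ := by gcongr
    linarith
  · push Not at hlow
    have hrz := hr_zero hlow
    rw [hrz] at hen hQnext
    have hX : 0 < P.cap - q.B := by linarith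
    rcases hr with h0 | h1 | h2
    · have hUz : P.lamE * P.eU x = 0 := by
        rw [h0] at hen
        refine le_antisymm ?_ hU0
        by_contra hne
        push Not at hne
        nlinarith [mul_pos hX hne]
      refine ⟨⟨hU0, ?_⟩, hQbound, ?_, Or.inl ?_⟩
      · rw [hUz]; split_ifs <;> simp [hB]
      · exact le_min (by linarith) hP.cap_pos.le
      · linarith
    · linarith
    -- Since `b ≤ QU`, one has `QU * b ≤ QU ^ 2 - (QU - b) ^ 2`; the energy bound divided by the
    -- deficit, which exceeds `X₁`, becomes a decrease of the potential.
    · have hspend : P.lamE * P.eU x ≤ q.QU ^ 2 / X₁ - (q.next P w x).QU ^ 2 / X₁ := by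
        rw [← sub_div, le_div_iff₀ hX₁pos, hQnext]
        have e1 : P.lamE * P.eU x * X₁ ≤ P.lamE * P.eU x * (P.cap - q.B) :=
          mul_le_mul_of_nonneg_left hlow.le hU0
        nlinarith
      refine ⟨high (by linarith), hQbound, ?_, Or.inr (Or.inr (by linarith))⟩
      have : 0 ≤ (q.next P w x).QU ^ 2 / X₁ := by positivity
      linarith

end Model

/-! ### Measurability of actions and backlogs -/

section Measurability

@[fun_prop]
lemma Env.measurable_a : Measurable Env.a :=
  (measurable_from_top (f := fun b : Bool => if b then (1 : ℝ) else 0)).comp measurable_fst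

@[fun_prop]
lemma Env.measurable_eh : Measurable Env.eh := by unfold Env.eh; fun_prop

@[fun_prop]
lemma Env.measurable_h : Measurable Env.h := by unfold Env.h; fun_prop

@[fun_prop]
lemma Env.measurable_g : Measurable Env.g := by unfold Env.g; fun_prop

@[fun_prop]
lemma Action.measurable_r : Measurable Action.r := by unfold Action.r; fun_prop

@[fun_prop]
lemma Action.measurable_p : Measurable Action.p := by unfold Action.p; fun_prop

@[fun_prop]
lemma Action.measurable_fu : Measurable Action.fu := by unfold Action.fu; fun_prop

@[fun_prop]
lemma Action.measurable_fs : Measurable Action.fs := by unfold Action.fs; fun_prop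

variable (P : Params)

@[fun_prop]
lemma Params.measurable_sinr : Measurable P.sinr := by unfold Params.sinr; fun_prop

@[fun_prop]
lemma Params.measurable_lOff : Measurable fun y : Env × Action => P.lOff y.1 y.2 := by
  unfold Params.lOff Real.logb; fun_prop

@[fun_prop]
lemma Params.measurable_lLoc : Measurable P.lLoc := by unfold Params.lLoc; fun_prop

@[fun_prop]
lemma Params.measurable_lEdg : Measurable P.lEdg := by unfold Params.lEdg; fun_prop

@[fun_prop]
lemma Params.measurable_eEdg : Measurable P.eEdg := by unfold Params.eEdg; fun_prop

@[fun_prop]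
lemma Params.measurable_eU : Measurable P.eU := by unfold Params.eU; fun_prop

@[fun_prop]
lemma measurable_event (t : ℕ) : Measurable (event t) := by unfold event; fun_prop

@[fun_prop]
lemma Policy.measurable_action (π : Policy) (t : ℕ) : Measurable (π.action t) :=
  (π.measurable_act t).comp (by fun_prop)

lemma Policy.measurable_queues (q₀ : Queues) (π : Policy) (t : ℕ) :
    Measurable (fun s => (π.queues P q₀ t s).QU) ∧ Measurable (fun s => (π.queues P q₀ t s).QS) ∧
      Measurable (fun s => (π.queues P q₀ t s).B) ∧
        Measurable (fun s => (π.queues P q₀ t s).Z) := by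
  induction t with
  | zero =>
    exact ⟨measurable_const (a := q₀.QU), measurable_const (a := q₀.QS),
      measurable_const (a := q₀.B), measurable_const (a := q₀.Z)⟩
  | succ t ih =>
    obtain ⟨h1, h2, h3, h4⟩ := ih
    have hoff : Measurable fun s => P.lOff (event t s) (π.action t s) :=
      P.measurable_lOff.comp ((measurable_event t).prodMk (π.measurable_action t))
    simp only [Policy.queues, Queues.next]
    refine ⟨by fun_prop, by fun_prop, by fun_prop, by fun_prop⟩

variable (q₀ : Queues) (π : Policy) (t : ℕ)

@[fun_prop]
lemma Policy.measurable_QU : Measurable fun s => (π.queues P q₀ t s).QU :=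
  (π.measurable_queues P q₀ t).1

@[fun_prop]
lemma Policy.measurable_QS : Measurable fun s => (π.queues P q₀ t s).QS :=
  (π.measurable_queues P q₀ t).2.1

@[fun_prop]
lemma Policy.measurable_B : Measurable fun s => (π.queues P q₀ t s).B :=
  (π.measurable_queues P q₀ t).2.2.1

@[fun_prop]
lemma Policy.measurable_Z : Measurable fun s => (π.queues P q₀ t s).Z :=
  (π.measurable_queues P q₀ t).2.2.2

@[fun_prop]
lemma Policy.measurable_lyapunov : Measurable fun s => lyapunov P (π.queues P q₀ t s) := by
  unfold lyapunov; fun_prop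

end Measurability

/-! ### Resampling the event of one slot -/

section Resampling

/-- The backlogs of slot `t` depend only on the seed and on the events before slot `t`. -/
lemma Policy.queues_congr (P : Params) (q₀ : Queues) (π : Policy) {t : ℕ} {s s' : Sample}
    (hseed : s.1 = s'.1) (h : ∀ i < t, s.2 i = s'.2 i) :
    π.queues P q₀ t s = π.queues P q₀ t s' := by
  induction t with
  | zero => rfl
  | succ t ih =>
    have h1 : π.action t s = π.action t s' := by
      unfold Policy.action
      rw [hseed]
      congr 2
      funext i
      exact h i i.2
    simp only [Policy.queues]
    rw [ih fun i hi => h i (hi.trans t.lt_succ_self), h1]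
    have : event t s = event t s' := h t t.lt_succ_self
    rw [this]

variable {μ : Measure Env} [IsProbabilityMeasure μ]

instance : IsProbabilityMeasure (sampleLaw μ) := by unfold sampleLaw; infer_instance

/-- It suffices to check cylinders. There the constraint on coordinate `t` passes to the fresh
variable, and the remaining constraints form a cylinder that ignores `t`. -/
lemma measurePreserving_update {E : Type*} [MeasurableSpace E] (m : Measure E)
    [IsProbabilityMeasure m] (t : ℕ) :
    MeasurePreserving (fun z : (ℕ → E) × E => Function.update z.1 t z.2)
      ((Measure.infinitePi fun _ : ℕ => m).prod m) (Measure.infinitePi fun _ : ℕ => m) := by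
  have hmeas : Measurable (fun z : (ℕ → E) × E => Function.update z.1 t z.2) := by
    rw [measurable_pi_iff]
    intro i
    by_cases h : i = t
    · subst h; simpa using measurable_snd
    · simp only [Function.update_of_ne h]; fun_prop
  refine ⟨hmeas, Measure.eq_infinitePi _ fun s T hT => ?_⟩
  rw [Measure.map_apply hmeas (MeasurableSet.pi s.countable_toSet fun i _ => hT i)]
  have hpre : (fun z : (ℕ → E) × E => Function.update z.1 t z.2) ⁻¹' (Set.pi s T)
      = (Set.pi (s.erase t : Finset ℕ) T) ×ˢ (if t ∈ s then T t else univ) := by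
    ext z
    simp only [mem_preimage, Set.mem_pi, mem_prod, Finset.mem_coe, Finset.mem_erase]
    constructor
    · intro h
      refine ⟨fun i hi => ?_, ?_⟩
      · simpa [Function.update_of_ne hi.1] using h i hi.2
      · split_ifs with ht
        · simpa using h t ht
        · trivial
    · rintro ⟨h1, h2⟩ i hi
      by_cases hit : i = t
      · subst hit; simpa [hi] using h2
      · simpa [Function.update_of_ne hit] using h1 i ⟨hit, hi⟩
  rw [hpre, Measure.prod_prod, Measure.infinitePi_pi _ fun i _ => hT i]
  split_ifs with ht
  · exact Finset.prod_erase_mul s _ ht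
  · rw [measure_univ, mul_one, Finset.erase_eq_of_notMem ht]

/-- Replace the event of slot `t`. -/
def resample (t : ℕ) (z : Sample × (Env × Action)) : Sample :=
  (z.1.1, Function.update z.1.2 t z.2.1)

/-- The fresh event comes with an action that may be correlated with it; both are independent of the
seed and the past, hence of the backlogs of slot `t`. -/
lemma measurePreserving_resample (ν : Measure (Env × Action)) [IsProbabilityMeasure ν]
    (hν : ν.map Prod.fst = μ) (t : ℕ) :
    MeasurePreserving (resample t) ((sampleLaw μ).prod ν) (sampleLaw μ) := by
  have h1 : MeasurePreserving (Prod.fst : Env × Action → Env) ν μ := ⟨measurable_fst, hν⟩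
  have h2 := (measurePreserving_update μ t).comp
    ((MeasurePreserving.id (Measure.infinitePi fun _ : ℕ => μ)).prod h1)
  have h3 := (MeasurePreserving.id (volume : Measure unitInterval)).prod h2
  exact h3.comp (measurePreserving_prodAssoc _ _ _)

lemma queues_resample (P : Params) (q₀ : Queues) (π : Policy) (t : ℕ)
    (z : Sample × (Env × Action)) :
    π.queues P q₀ t (resample t z) = π.queues P q₀ t z.1 :=
  π.queues_congr P q₀ rfl fun i hi => by simp [resample, hi.ne]

lemma event_resample (t : ℕ) (z : Sample × (Env × Action)) : event t (resample t z) = z.2.1 := by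
  simp [event, resample]

lemma measurePreserving_event (μ : Measure Env) [IsProbabilityMeasure μ] (t : ℕ) :
    MeasurePreserving (event t) (sampleLaw μ) μ :=
  (measurePreserving_eval_infinitePi (fun _ : ℕ => μ) t).comp measurePreserving_snd

end Resampling

/-! ### Almost sure bounds and integrability of the backlogs -/

section Bounds

lemma integrable_of_measurable_of_bound {S : Type*} [MeasurableSpace S] {m : Measure S}
    [IsFiniteMeasure m] {f : S → ℝ} (hf : Measurable f) (c : ℝ) (hc : ∀ᵐ s ∂m, ‖f s‖ ≤ c) :
    Integrable f m :=
  .of_bound hf.aestronglyMeasurable c hc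

variable {P : Params} {μ : Measure Env} [IsProbabilityMeasure μ] {q₀ : Queues} {π : Policy}

omit [IsProbabilityMeasure μ] in
lemma EnvLaw.regular (hμ : EnvLaw P μ) : ∀ᵐ w ∂μ, w.Regular P := by
  filter_upwards [hμ.gains_nonneg, hμ.harvest] with w h1 h2 using ⟨h1, h2⟩

lemma EnvLaw.regular_event (hμ : EnvLaw P μ) (t : ℕ) :
    ∀ᵐ s ∂sampleLaw μ, (event t s).Regular P :=
  (measurePreserving_event μ t).quasiMeasurePreserving.ae hμ.regular

lemma ae_proper (hP : P.Valid) (hμ : EnvLaw P μ) (hq₀ : q₀.Proper P)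
    (hπ : ∀ t, ∀ᵐ s ∂sampleLaw μ, SlotFeasible P (π.queues P q₀ t s) (event t s) (π.action t s))
    (t : ℕ) : ∀ᵐ s ∂sampleLaw μ, (π.queues P q₀ t s).Proper P := by
  induction t with
  | zero => exact ae_of_all _ fun _ => hq₀
  | succ t ih =>
    filter_upwards [hπ t, hμ.regular_event t] with s h1 h2 using h1.proper_next hP h2

/-- Every backlog of a fixed slot is essentially bounded although `lOffMax` need not be: data
causality limits the offloaded data by `QU`, so `QS` grows by at most the previous bound. This makes
the Lyapunov function integrable without moment estimates. -/
lemma exists_queues_bound (hP : P.Valid) (hμ : EnvLaw P μ) (hq₀ : q₀.Proper P)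
    (hπ : ∀ t, ∀ᵐ s ∂sampleLaw μ, SlotFeasible P (π.queues P q₀ t s) (event t s) (π.action t s))
    (t : ℕ) : ∃ c, ∀ᵐ s ∂sampleLaw μ,
      |(π.queues P q₀ t s).QU| ≤ c ∧ |(π.queues P q₀ t s).QS| ≤ c ∧
        |P.cap - (π.queues P q₀ t s).B| ≤ c ∧ |(π.queues P q₀ t s).Z| ≤ c := by
  suffices h : ∃ c, ∀ᵐ s ∂sampleLaw μ,
      (π.queues P q₀ t s).QU ≤ c ∧ (π.queues P q₀ t s).QS ≤ c ∧
        P.cap - (π.queues P q₀ t s).B ≤ c ∧ (π.queues P q₀ t s).Z ≤ c by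
    obtain ⟨c, hc⟩ := h
    refine ⟨c, ?_⟩
    filter_upwards [hc, ae_proper hP hμ hq₀ hπ t] with s h1 h2
    rw [abs_of_nonneg h2.QU_nonneg, abs_of_nonneg h2.QS_nonneg, abs_of_nonneg h2.Z_nonneg,
      abs_of_nonneg (sub_nonneg.2 h2.B_le)]
    exact h1
  induction t with
  | zero =>
    refine ⟨max (max q₀.QU q₀.QS) (max (P.cap - q₀.B) q₀.Z), ae_of_all _ fun s => ?_⟩
    simp [Policy.queues]
  | succ t ih =>
    obtain ⟨c, hc⟩ := ih
    have hle := hP.lamE_pos.le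
    have hlc := hP.lamC_pos.le
    have hUmax : 0 ≤ P.lamE * P.eUMax := mul_nonneg hle
      ((eU_nonneg hP (x := (0, 0, 0, 0)) ⟨⟨le_rfl, hP.rmax_nonneg⟩, ⟨le_rfl, hP.pmax_nonneg⟩,
        ⟨le_rfl, hP.fumax_nonneg⟩, le_rfl, hP.fsmax_nonneg⟩).trans
      (eU_le_eUMax hP ⟨⟨le_rfl, hP.rmax_nonneg⟩, ⟨le_rfl, hP.pmax_nonneg⟩,
        ⟨le_rfl, hP.fumax_nonneg⟩, le_rfl, hP.fsmax_nonneg⟩))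
    have hEmax : 0 ≤ P.lamC * P.eEdgMax := mul_nonneg hlc
      ((eEdg_nonneg hP (x := (0, 0, 0, 0)) ⟨⟨le_rfl, hP.rmax_nonneg⟩, ⟨le_rfl, hP.pmax_nonneg⟩,
        ⟨le_rfl, hP.fumax_nonneg⟩, le_rfl, hP.fsmax_nonneg⟩).trans
      (eEdg_le_eEdgMax hP ⟨⟨le_rfl, hP.rmax_nonneg⟩, ⟨le_rfl, hP.pmax_nonneg⟩,
        ⟨le_rfl, hP.fumax_nonneg⟩, le_rfl, hP.fsmax_nonneg⟩))
    have hr := hP.rmax_nonneg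
    refine ⟨2 * c + P.rmax + P.lamE * P.eUMax + P.lamC * P.eEdgMax, ?_⟩
    filter_upwards [hc, hπ t, hμ.regular_event t, ae_proper hP hμ hq₀ hπ t]
      with s ⟨h1, h2, h3, h4⟩ ⟨_, ⟨⟨b0, b1⟩, c0, c1⟩, hb⟩ hw hq
    have k1 := lLoc_nonneg hP hb
    have k2 := mul_le_mul_of_nonneg_left (eU_le_eUMax hP hb) hle
    have k3 := mul_le_mul_of_nonneg_left (eEdg_le_eEdgMax hP hb) hlc
    have k4 := mul_nonneg hle hw.2.1
    have k5 := mul_nonneg hlc hP.cth_nonneg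
    have k6 := hb.1.2
    have k7 := hq.QU_nonneg
    simp only [Policy.queues, Queues.next]
    refine ⟨by linarith, by linarith, ?_, max_le (by linarith) (by linarith)⟩
    rw [sub_le_comm]
    exact le_min (by linarith) (by linarith)

lemma integrable_queues (hP : P.Valid) (hμ : EnvLaw P μ) (hq₀ : q₀.Proper P)
    (hπ : ∀ t, ∀ᵐ s ∂sampleLaw μ, SlotFeasible P (π.queues P q₀ t s) (event t s) (π.action t s))
    (t : ℕ) : Integrable (fun s => (π.queues P q₀ t s).QU) (sampleLaw μ) ∧
      Integrable (fun s => (π.queues P q₀ t s).QS) (sampleLaw μ) ∧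
      Integrable (fun s => P.cap - (π.queues P q₀ t s).B) (sampleLaw μ) ∧
      Integrable (fun s => (π.queues P q₀ t s).Z) (sampleLaw μ) ∧
      Integrable (fun s => lyapunov P (π.queues P q₀ t s)) (sampleLaw μ) := by
  obtain ⟨c, hc⟩ := exists_queues_bound hP hμ hq₀ hπ t
  refine ⟨integrable_of_measurable_of_bound (π.measurable_QU P q₀ t) c ?_,
    integrable_of_measurable_of_bound (π.measurable_QS P q₀ t) c ?_,
    integrable_of_measurable_of_bound ((π.measurable_B P q₀ t).const_sub _) c ?_,
    integrable_of_measurable_of_bound (π.measurable_Z P q₀ t) c ?_,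
    integrable_of_measurable_of_bound (π.measurable_lyapunov P q₀ t) (2 * c ^ 2) ?_⟩
  · filter_upwards [hc] with s h using h.1
  · filter_upwards [hc] with s h using h.2.1
  · filter_upwards [hc] with s h using h.2.2.1
  · filter_upwards [hc] with s h using h.2.2.2
  · filter_upwards [hc] with s ⟨h1, h2, h3, h4⟩
    rw [Real.norm_of_nonneg (lyapunov_nonneg _ _), lyapunov]
    have := sq_le_sq' (abs_le.1 h1).1 (abs_le.1 h1).2
    have := sq_le_sq' (abs_le.1 h2).1 (abs_le.1 h2).2
    have := sq_le_sq' (abs_le.1 h3).1 (abs_le.1 h3).2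
    have := sq_le_sq' (abs_le.1 h4).1 (abs_le.1 h4).2
    linarith

end Bounds

/-! ### Expected drift against an independent competitor -/

section Comparison

variable {P : Params} {μ : Measure Env}

/-- A joint law of an event and an action: the event has law `μ`, the action almost surely meets the
box and interference constraints. -/
structure AdmissibleLaw (P : Params) (μ : Measure Env) (ν : Measure (Env × Action)) : Prop where
  map_fst : ν.map Prod.fst = μ
  admissible : ∀ᵐ y ∂ν, P.QoS y.1 y.2 ∧ P.Box y.2

variable {ν : Measure (Env × Action)}

lemma AdmissibleLaw.ae_fst (hν : AdmissibleLaw P μ ν) {p : Env → Prop} (hp : ∀ᵐ w ∂μ, p w) :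
    ∀ᵐ y ∂ν, p y.1 :=
  (MeasurePreserving.mk measurable_fst hν.map_fst).quasiMeasurePreserving.ae hp

lemma AdmissibleLaw.integrable [IsProbabilityMeasure μ] [IsProbabilityMeasure ν]
    (hν : AdmissibleLaw P μ ν) (hP : P.Valid) (hμ : EnvLaw P μ) :
    Integrable (fun y => y.2.r) ν ∧ Integrable (fun y => P.eEdg y.2) ν ∧
      Integrable (fun y => P.eU y.2 - y.1.eh) ν ∧ Integrable (fun y => P.lOff y.1 y.2) ν ∧
      Integrable (fun y => P.lLoc y.2) ν ∧ Integrable (fun y => P.lEdg y.2) ν := by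
  have hreg := hν.ae_fst hμ.regular
  have hadm := hν.admissible
  refine ⟨integrable_of_measurable_of_bound (by fun_prop) P.rmax ?_,
    integrable_of_measurable_of_bound (by fun_prop) P.eEdgMax ?_,
    .sub (integrable_of_measurable_of_bound (by fun_prop) P.eUMax ?_)
      (integrable_of_measurable_of_bound (by fun_prop) P.Ehmax ?_),
    ?_, integrable_of_measurable_of_bound (by fun_prop) P.lLocMax ?_,
    integrable_of_measurable_of_bound (by fun_prop) P.lEdgMax ?_⟩
  · filter_upwards [hadm] with y ⟨_, h⟩
    rw [Real.norm_of_nonneg h.1.1]; exact h.1.2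
  · filter_upwards [hadm] with y ⟨_, h⟩
    rw [Real.norm_of_nonneg (eEdg_nonneg hP h)]; exact eEdg_le_eEdgMax hP h
  · filter_upwards [hadm] with y ⟨_, h⟩
    rw [Real.norm_of_nonneg (eU_nonneg hP h)]; exact eU_le_eUMax hP h
  · filter_upwards [hreg] with y h
    rw [Real.norm_of_nonneg h.2.1]; exact h.2.2
  · have h1 : Integrable (fun y : Env × Action => P.lOffMax y.1) ν :=
      (MeasurePreserving.mk measurable_fst hν.map_fst).integrable_comp_of_integrable
        (hμ.lOffMax_memLp.integrable (by norm_num))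
    refine h1.mono' (P.measurable_lOff.aestronglyMeasurable) ?_
    filter_upwards [hreg, hadm] with y hw ⟨_, h⟩
    rw [Real.norm_of_nonneg (lOff_nonneg hP hw h.2.1.1)]
    exact lOff_le_lOffMax hP hw h
  · filter_upwards [hadm] with y ⟨_, h⟩
    rw [Real.norm_of_nonneg (lLoc_nonneg hP h)]; exact lLoc_le_lLocMax hP h
  · filter_upwards [hadm] with y ⟨_, h⟩
    rw [Real.norm_of_nonneg (lEdg_nonneg hP h)]; exact lEdg_le_lEdgMax hP h

lemma EnvLaw.integral_slotDrift [IsProbabilityMeasure μ] (hμ : EnvLaw P μ) :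
    Integrable (slotDrift P) μ ∧ ∫ w, slotDrift P w ∂μ = P.driftConst μ := by
  have h1 : Integrable (fun w => P.lOffMax w ^ 2) μ := hμ.lOffMax_memLp.integrable_sq
  have h2 : Integrable (fun w => (P.lOffMax w + P.lLocMax) ^ 2) μ :=
    (hμ.lOffMax_memLp.add (memLp_const P.lLocMax)).integrable_sq
  have e : slotDrift P = fun w => (1 / 2) * (((P.lamC * P.eEdgMax) ^ 2 + (P.lamC * P.cth) ^ 2
      + (P.lamE * P.eUMax) ^ 2 + (P.lamE * P.Ehmax) ^ 2 + P.rmax ^ 2 + P.lEdgMax ^ 2)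
      + ((P.lOffMax w + P.lLocMax) ^ 2 + P.lOffMax w ^ 2)) := by
    funext w; unfold slotDrift; ring
  have h3 : Integrable (fun w => (P.lOffMax w + P.lLocMax) ^ 2 + P.lOffMax w ^ 2) μ := h2.add h1
  refine ⟨?_, ?_⟩
  · rw [e]
    exact ((integrable_const _).add h3).const_mul _
  · rw [e, integral_const_mul, integral_add (integrable_const _) h3, integral_add h2 h1,
      integral_const, Params.driftConst]
    simp only [probReal_univ, smul_eq_mul, one_mul]
    ring

variable [IsProbabilityMeasure μ] {q₀ : Queues} {π : Policy}

/-- Expected energy deficit of the battery. -/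
noncomputable def meanDeficit (P : Params) (μ : Measure Env) [IsProbabilityMeasure μ] (q₀ : Queues)
    (π : Policy) (t : ℕ) : ℝ := ∫ s, (P.cap - (π.queues P q₀ t s).B) ∂sampleLaw μ

/-- Expected backlog of the virtual queue. -/
noncomputable def meanZ (P : Params) (μ : Measure Env) [IsProbabilityMeasure μ] (q₀ : Queues)
    (π : Policy) (t : ℕ) : ℝ := ∫ s, (π.queues P q₀ t s).Z ∂sampleLaw μ

/-- Expected value of the Lyapunov function. -/
noncomputable def meanLyapunov (P : Params) (μ : Measure Env) [IsProbabilityMeasure μ]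
    (q₀ : Queues) (π : Policy) (t : ℕ) : ℝ := ∫ s, lyapunov P (π.queues P q₀ t s) ∂sampleLaw μ

lemma integrable_rate
    (hπ : ∀ t, ∀ᵐ s ∂sampleLaw μ, SlotFeasible P (π.queues P q₀ t s) (event t s) (π.action t s))
    (t : ℕ) : Integrable (fun s => (π.action t s).r) (sampleLaw μ) := by
  refine integrable_of_measurable_of_bound (by fun_prop) P.rmax ?_
  filter_upwards [hπ t] with s ⟨_, _, h⟩
  rw [Real.norm_of_nonneg h.1.1]; exact h.1.2

/-- Expected drift-plus-penalty bound for PLySE against an action drawn from any admissible law. -/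
lemma meanLyapunov_drift_le [IsProbabilityMeasure ν] (hP : P.Valid) (hμ : EnvLaw P μ)
    (hq₀ : q₀.Proper P) {V : ℝ} (hπ : IsPLySE P μ q₀ V π) (hν : AdmissibleLaw P μ ν) (t : ℕ) :
    meanLyapunov P μ q₀ π (t + 1) - meanLyapunov P μ q₀ π t - V * meanRate μ π t ≤
      P.driftConst μ - (V * ∫ y, y.2.r ∂ν
        + meanZ P μ q₀ π t * (P.lamC * (P.cth - ∫ y, P.eEdg y.2 ∂ν))
        - meanDeficit P μ q₀ π t * (P.lamE * ∫ y, (P.eU y.2 - y.1.eh) ∂ν)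
        + meanQU P μ q₀ π t * (∫ y, P.lOff y.1 y.2 ∂ν + ∫ y, P.lLoc y.2 ∂ν - ∫ y, y.2.r ∂ν)
        + meanQS P μ q₀ π t * (∫ y, P.lEdg y.2 ∂ν - ∫ y, P.lOff y.1 y.2 ∂ν)) := by
  have hfeas := fun t => (hπ t).mono fun s h => h.1
  obtain ⟨iQU, iQS, iX, iZ, iL⟩ := integrable_queues hP hμ hq₀ hfeas t
  obtain ⟨-, -, -, -, iL'⟩ := integrable_queues hP hμ hq₀ hfeas (t + 1)
  have ir := integrable_rate hfeas t
  obtain ⟨jr, jE, jU, jO, jl, jG⟩ := hν.integrable hP hμ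
  have hΦ := measurePreserving_resample ν hν.map_fst t
  have hfst : MeasurePreserving (Prod.fst : Env × Action → Env) ν μ := ⟨measurable_fst, hν.map_fst⟩
  have hsnd : MeasurePreserving (Prod.snd : Sample × (Env × Action) → Env × Action)
      ((sampleLaw μ).prod ν) ν := measurePreserving_snd
  obtain ⟨jD, hD⟩ := hμ.integral_slotDrift
  have jD' : Integrable (fun y : Env × Action => slotDrift P y.1) ν :=
    hfst.integrable_comp_of_integrable jD
  have hD' : ∫ y, slotDrift P y.1 ∂ν = P.driftConst μ := by
    rw [← hD, ← hν.map_fst, integral_map (by fun_prop)]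
    rw [hν.map_fst]; exact jD.aestronglyMeasurable
  set G : Sample → ℝ := fun s => lyapunov P (π.queues P q₀ (t + 1) s)
    - lyapunov P (π.queues P q₀ t s) - V * (π.action t s).r with hG
  have iG : Integrable G (sampleLaw μ) := (iL'.sub iL).sub (ir.const_mul V)
  have hGint : ∫ s, G s ∂sampleLaw μ = meanLyapunov P μ q₀ π (t + 1)
      - meanLyapunov P μ q₀ π t - V * meanRate μ π t := by
    have h : Integrable (fun s => lyapunov P (π.queues P q₀ (t + 1) s)
      - lyapunov P (π.queues P q₀ t s)) (sampleLaw μ) := iL'.sub iL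
    simp only [hG]
    rw [integral_sub h (ir.const_mul V), integral_sub iL' iL, integral_const_mul]
    rfl
  -- The drift of slot `t` may be computed on the resampled run, where the competitor's action is
  -- available for the very event that PLySE faces.
  have hGΦ : ∫ z, G (resample t z) ∂(sampleLaw μ).prod ν = ∫ s, G s ∂sampleLaw μ := by
    conv_rhs => rw [← hΦ.map_eq]
    rw [integral_map hΦ.measurable.aemeasurable]
    rw [hΦ.map_eq]; exact iG.aestronglyMeasurable
  have l1 : Integrable (fun y : Env × Action => slotDrift P y.1 - V * y.2.r) ν :=
    jD'.sub (jr.const_mul V)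
  have l2 : Integrable (fun y : Env × Action => P.lamC * (P.cth - P.eEdg y.2)) ν :=
    ((integrable_const P.cth).sub jE).const_mul P.lamC
  have l4' : Integrable (fun y : Env × Action => P.lOff y.1 y.2 + P.lLoc y.2) ν := jO.add jl
  have l4 : Integrable (fun y : Env × Action => P.lOff y.1 y.2 + P.lLoc y.2 - y.2.r) ν := l4'.sub jr
  have l5 : Integrable (fun y : Env × Action => P.lEdg y.2 - P.lOff y.1 y.2) ν := jG.sub jO
  have i1 := l1.comp_snd (sampleLaw μ)
  have i2 := iZ.mul_prod l2
  have i3 := iX.mul_prod (jU.const_mul P.lamE)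
  have i4 := iQU.mul_prod l4
  have i5 := iQS.mul_prod l5
  have i12 := i1.sub' i2
  have i123 := i12.fun_add i3
  have i1234 := i123.sub' i4
  rw [← hGint, ← hGΦ]
  have key : ∫ z, G (resample t z) ∂(sampleLaw μ).prod ν ≤ ∫ z, (slotDrift P z.2.1 - V * z.2.2.r
      - (π.queues P q₀ t z.1).Z * (P.lamC * (P.cth - P.eEdg z.2.2))
      + (P.cap - (π.queues P q₀ t z.1).B) * (P.lamE * (P.eU z.2.2 - z.2.1.eh))
      - (π.queues P q₀ t z.1).QU * (P.lOff z.2.1 z.2.2 + P.lLoc z.2.2 - z.2.2.r)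
      - (π.queues P q₀ t z.1).QS * (P.lEdg z.2.2 - P.lOff z.2.1 z.2.2))
      ∂(sampleLaw μ).prod ν := by
    refine integral_mono_ae (hΦ.integrable_comp_of_integrable iG)
      (i1234.sub i5) ?_
    filter_upwards [hΦ.quasiMeasurePreserving.ae (hπ t),
      hΦ.quasiMeasurePreserving.ae (ae_proper hP hμ hq₀ hfeas t),
      hsnd.quasiMeasurePreserving.ae hν.admissible,
      hsnd.quasiMeasurePreserving.ae (hν.ae_fst hμ.regular)] with z h1 h2 h3 h4
    have h5 := queues_resample P q₀ π t z
    have h6 := event_resample t z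
    rw [h6] at h1
    have := lyapunov_next_le hP h2 h4 h1.1 h1.2 h3.2 h3.1
    have h7 : π.queues P q₀ (t + 1) (resample t z)
      = (π.queues P q₀ t (resample t z)).next P z.2.1 (π.action t (resample t z)) := by
        rw [← h6]; rfl
    rw [← h7, h5] at this
    simp only [hG, h5]
    refine this.trans (le_of_eq ?_)
    unfold slotObj
    ring
  -- By independence, each backlog factors out of the integral of its competitor term.
  refine key.trans (le_of_eq ?_)
  rw [integral_sub i1234 i5, integral_sub i123 i4, integral_add i12 i3, integral_sub i1 i2,
    integral_fun_snd (fun y : Env × Action => slotDrift P y.1 - V * y.2.r),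
    integral_prod_mul (fun s => (π.queues P q₀ t s).Z) (fun y : Env × Action => P.lamC * (P.cth - P.eEdg y.2)),
    integral_prod_mul (fun s => P.cap - (π.queues P q₀ t s).B) (fun y : Env × Action => P.lamE * (P.eU y.2 - y.1.eh)),
    integral_prod_mul (fun s => (π.queues P q₀ t s).QU)
      (fun y : Env × Action => P.lOff y.1 y.2 + P.lLoc y.2 - y.2.r),
    integral_prod_mul (fun s => (π.queues P q₀ t s).QS) (fun y : Env × Action => P.lEdg y.2 - P.lOff y.1 y.2),
    integral_sub jD' (jr.const_mul V), integral_const_mul, integral_const_mul, integral_const_mul,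
    integral_sub (integrable_const _) jE, integral_sub l4' jr, integral_add jO jl,
    integral_sub jG jO, hD']
  simp only [integral_const, probReal_univ, smul_eq_mul, one_mul]
  unfold meanZ meanDeficit meanQU meanQS
  ring

end Comparison

/-! ### Cesàro averages and sublinear growth -/

section Averages

/-- Moves between extended-real limits and linear bounds on partial sums; the average at `N = 0` is
a division by zero, irrelevant in the limit. -/
lemma limsupAvg_le_iff {u : ℕ → ℝ} {a : ℝ} : limsupAvg u ≤ (a : EReal) ↔
    ∀ δ > 0, ∀ᶠ N : ℕ in atTop, ∑ t ∈ Finset.range N, u t ≤ (a + δ) * N := by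
  constructor
  · intro h δ hδ
    have h1 : limsupAvg u < ((a + δ : ℝ) : EReal) :=
      h.trans_lt (EReal.coe_lt_coe_iff.2 (by linarith))
    filter_upwards [eventually_lt_of_limsup_lt h1, eventually_gt_atTop 0] with N hN hN0
    rw [EReal.coe_lt_coe_iff, div_lt_iff₀ (by exact_mod_cast hN0)] at hN
    exact hN.le
  · intro h
    by_contra! hlt
    obtain ⟨c, hc1, hc2⟩ := EReal.lt_iff_exists_real_btwn.1 hlt
    have hac : a < c := EReal.coe_lt_coe_iff.1 hc1
    obtain ⟨N, hN1, hN2, hN3⟩ := ((frequently_lt_of_lt_limsup (by isBoundedDefault) hc2).and_eventually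
      ((h (c - a) (by linarith)).and (eventually_gt_atTop 0))).exists
    rw [EReal.coe_lt_coe_iff, lt_div_iff₀ (by exact_mod_cast hN3)] at hN1
    linarith

lemma le_liminfAvg {u : ℕ → ℝ} {a : ℝ}
    (h : ∀ δ > 0, ∀ᶠ N : ℕ in atTop, (a - δ) * N ≤ ∑ t ∈ Finset.range N, u t) :
    (a : EReal) ≤ liminfAvg u := by
  by_contra! hlt
  obtain ⟨c, hc1, hc2⟩ := EReal.lt_iff_exists_real_btwn.1 hlt
  have hac : c < a := EReal.coe_lt_coe_iff.1 hc2
  obtain ⟨N, hN1, hN2, hN3⟩ := ((frequently_lt_of_liminf_lt (by isBoundedDefault) hc1).and_eventually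
    ((h (a - c) (by linarith)).and (eventually_gt_atTop 0))).exists
  rw [EReal.coe_lt_coe_iff, div_lt_iff₀ (by exact_mod_cast hN3)] at hN1
  linarith

lemma eventually_const_le_mul (c : ℝ) {δ : ℝ} (hδ : 0 < δ) : ∀ᶠ N : ℕ in atTop, c ≤ δ * N := by
  have : Tendsto (fun N : ℕ => δ * (N : ℝ)) atTop atTop :=
    tendsto_natCast_atTop_atTop.const_mul_atTop hδ
  exact this.eventually_ge_atTop c

lemma limsupAvg_le_of_sum_le {u : ℕ → ℝ} {a c : ℝ}
    (h : ∀ N : ℕ, ∑ t ∈ Finset.range N, u t ≤ a * N + c) : limsupAvg u ≤ (a : EReal) := by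
  refine limsupAvg_le_iff.2 fun δ hδ => ?_
  filter_upwards [eventually_const_le_mul c hδ] with N hN
  linarith [h N]

lemma le_liminfAvg_of_le_sum {u : ℕ → ℝ} {a c : ℝ}
    (h : ∀ N : ℕ, a * N - c ≤ ∑ t ∈ Finset.range N, u t) : (a : EReal) ≤ liminfAvg u := by
  refine le_liminfAvg fun δ hδ => ?_
  filter_upwards [eventually_const_le_mul c hδ] with N hN
  linarith [h N]

lemma liminfAvg_le_limsupAvg (u : ℕ → ℝ) : liminfAvg u ≤ limsupAvg u :=
  liminf_le_limsup

lemma exists_coe_eq {x : EReal} {a b : ℝ} (ha : (a : EReal) ≤ x) (hb : x ≤ (b : EReal)) :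
    ∃ v : ℝ, x = (v : EReal) :=
  ⟨x.toReal, (EReal.coe_toReal (hb.trans_lt (EReal.coe_lt_top b)).ne
    ((EReal.bot_lt_coe a).trans_le ha).ne').symm⟩

/-- A nonnegative sequence with bounded averages and increments bounded above grows sublinearly. -/
lemma eventually_le_mul_of_avg_bounded {u : ℕ → ℝ} {c : ℝ} (hu : ∀ n, 0 ≤ u n)
    (hc : ∀ n, u (n + 1) ≤ u n + c) (hlim : limsupAvg u < ⊤) {δ : ℝ} (hδ : 0 < δ) :
    ∀ᶠ N : ℕ in atTop, u N ≤ δ * N := by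
  wlog hc0 : 0 ≤ c generalizing c
  · exact this (c := 0) (fun n => (hc n).trans (by linarith)) le_rfl
  obtain ⟨C, hC1, -⟩ := EReal.lt_iff_exists_real_btwn.1 hlim
  have hC := limsupAvg_le_iff.1 hC1.le 1 one_pos
  have hstep : ∀ j k, u (j + k) ≤ u j + c * k := by
    intro j k
    induction k with
    | zero => simp
    | succ k ih =>
      have := hc (j + k)
      push_cast
      rw [← add_assoc]
      linarith
  have hsq : ∀ᶠ N : ℕ in atTop, (C + 1 + c) ≤ δ * (Nat.sqrt N : ℝ) := by
    have : Tendsto Nat.sqrt atTop atTop :=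
      tendsto_atTop.2 fun K => (eventually_ge_atTop (K * K)).mono fun N hN => Nat.le_sqrt.2 hN
    exact this.eventually (eventually_const_le_mul _ hδ)
  filter_upwards [hC, hsq, eventually_gt_atTop 0] with N h1 h2 hN
  -- If `u N` is large, so are the `m` terms before it, up to `c * m` each. Hence `m * u N` is at
  -- most the partial sum plus `c * m ^ 2`, that is `O(N)`; the choice `m ≈ √N` keeps the correction
  -- linear in `N` while `m` tends to infinity.
  set m := Nat.sqrt N with hm
  have hm0 : 0 < m := Nat.sqrt_pos.2 hN
  have hmm : m * m ≤ N := Nat.sqrt_le N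
  have hmN : m ≤ N := Nat.sqrt_le_self N
  have hsum : (m : ℝ) * u N ≤ ∑ j ∈ Finset.range N, u j + c * (m * m) := by
    have e1 : (m : ℝ) * u N = ∑ j ∈ Finset.Ico (N - m) N, u N := by
      rw [Finset.sum_const, Nat.card_Ico, nsmul_eq_mul, Nat.sub_sub_self hmN]
    have e2 : ∑ j ∈ Finset.Ico (N - m) N, u N ≤ ∑ j ∈ Finset.Ico (N - m) N, (u j + c * m) := by
      refine Finset.sum_le_sum fun j hj => ?_
      rw [Finset.mem_Ico] at hj
      have h3 := hstep j (N - j)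
      rw [Nat.add_sub_cancel' hj.2.le] at h3
      have h4 : ((N - j : ℕ) : ℝ) ≤ m := by exact_mod_cast (by omega : N - j ≤ m)
      have := mul_le_mul_of_nonneg_left h4 hc0
      linarith
    have e3 : ∑ j ∈ Finset.Ico (N - m) N, u j ≤ ∑ j ∈ Finset.range N, u j := by
      refine Finset.sum_le_sum_of_subset_of_nonneg (fun j hj => ?_) fun j _ _ => hu j
      rw [Finset.mem_Ico] at hj
      exact Finset.mem_range.2 hj.2
    rw [← e1, Finset.sum_add_distrib, Finset.sum_const, Nat.card_Ico, nsmul_eq_mul,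
      Nat.sub_sub_self hmN] at e2
    linarith
  have hm0' : (0 : ℝ) < m := by exact_mod_cast hm0
  have hmm' : (m : ℝ) * m ≤ N := by exact_mod_cast hmm
  have h5 := mul_le_mul_of_nonneg_left hmm' hc0
  have h6 := mul_le_mul_of_nonneg_right h2 (Nat.cast_nonneg (α := ℝ) N)
  refine le_of_mul_le_mul_left ?_ hm0'
  linarith

lemma StronglyStable.of_nonneg {S : Type*} [MeasurableSpace S] {m : Measure S} {X : ℕ → S → ℝ}
    (hX : ∀ t, Integrable (X t) m) (hX0 : ∀ t, ∀ᵐ s ∂m, 0 ≤ X t s)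
    (hlim : limsupAvg (fun t => ∫ s, X t s ∂m) < ⊤) : StronglyStable m X := by
  refine ⟨hX, ?_⟩
  have : (fun t => ∫ s, |X t s| ∂m) = fun t => ∫ s, X t s ∂m := by
    funext t
    exact integral_congr_ae ((hX0 t).mono fun s hs => abs_of_nonneg hs)
  rwa [this]

lemma StronglyStable.limsupAvg_lt_top {S : Type*} [MeasurableSpace S] {m : Measure S}
    {X : ℕ → S → ℝ} (hX : StronglyStable m X) (hX0 : ∀ t, ∀ᵐ s ∂m, 0 ≤ X t s) :
    limsupAvg (fun t => ∫ s, X t s ∂m) < ⊤ := by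
  have : (fun t => ∫ s, X t s ∂m) = fun t => ∫ s, |X t s| ∂m := by
    funext t
    exact integral_congr_ae ((hX0 t).mono fun s hs => (abs_of_nonneg hs).symm)
  rw [this]
  exact hX.2

end Averages

/-! ### Mean dynamics of a feasible policy -/

section FeasibleRuns

variable {P : Params} {μ : Measure Env} [IsProbabilityMeasure μ] {q₀ : Queues} {π : Policy}

/-- Joint law of the event and the action of slot `t`. -/
noncomputable def slotLaw (μ : Measure Env) [IsProbabilityMeasure μ] (π : Policy) (t : ℕ) :
    Measure (Env × Action) :=
  (sampleLaw μ).map fun s => (event t s, π.action t s)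

instance (t : ℕ) : IsProbabilityMeasure (slotLaw μ π t) :=
  Measure.isProbabilityMeasure_map (by fun_prop)

lemma integral_slotLaw {f : Env × Action → ℝ} (hf : Measurable f) (t : ℕ) :
    ∫ y, f y ∂slotLaw μ π t = ∫ s, f (event t s, π.action t s) ∂sampleLaw μ :=
  integral_map (by fun_prop) hf.aestronglyMeasurable

/-- However an action depends on the past and the seed, its joint law with the current event is an
admissible competitor. -/
lemma admissibleLaw_slotLaw
    (hπ : ∀ t, ∀ᵐ s ∂sampleLaw μ, SlotFeasible P (π.queues P q₀ t s) (event t s) (π.action t s))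
    (t : ℕ) : AdmissibleLaw P μ (slotLaw μ π t) := by
  have hm : Measurable fun s => (event t s, π.action t s) := by fun_prop
  refine ⟨?_, ?_⟩
  · rw [slotLaw, Measure.map_map measurable_fst hm]
    exact (measurePreserving_event μ t).map_eq
  · have hset : MeasurableSet {y : Env × Action | P.QoS y.1 y.2 ∧ P.Box y.2} := by
      have h0 : Measurable fun y : Env × Action => y.1.hbar := by unfold Env.hbar; fun_prop
      have h1 : MeasurableSet {y : Env × Action | P.QoS y.1 y.2} := by
        unfold Params.QoS
        exact measurableSet_le (by fun_prop) measurable_const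
      have h2 : MeasurableSet {x : Action | P.Box x} := by
        have h (f : Action → ℝ) (hf : Measurable f) (c : ℝ) : MeasurableSet {x | 0 ≤ f x ∧ f x ≤ c} :=
          hf measurableSet_Icc
        exact (h _ (by fun_prop) _).inter ((h _ (by fun_prop) _).inter
          ((h Action.fu (by fun_prop) _).inter (h Action.fs (by fun_prop) _)))
      exact h1.inter (measurable_snd h2)
    refine (ae_map_iff hm.aemeasurable hset).2 ?_
    filter_upwards [hπ t] with s h using ⟨h.1, h.2.2⟩

lemma integrable_slot (hP : P.Valid) (hμ : EnvLaw P μ)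
    (hπ : ∀ t, ∀ᵐ s ∂sampleLaw μ, SlotFeasible P (π.queues P q₀ t s) (event t s) (π.action t s))
    (t : ℕ) : Integrable (fun s => (π.action t s).r) (sampleLaw μ) ∧
      Integrable (fun s => P.eEdg (π.action t s)) (sampleLaw μ) ∧
      Integrable (fun s => P.eU (π.action t s) - (event t s).eh) (sampleLaw μ) ∧
      Integrable (fun s => P.lOff (event t s) (π.action t s)) (sampleLaw μ) ∧
      Integrable (fun s => P.lLoc (π.action t s)) (sampleLaw μ) ∧
      Integrable (fun s => P.lEdg (π.action t s)) (sampleLaw μ) := by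
  have hm : Measurable fun s => (event t s, π.action t s) := by fun_prop
  obtain ⟨h1, h2, h3, h4, h5, h6⟩ := (admissibleLaw_slotLaw hπ t).integrable hP hμ
  exact ⟨h1.comp_measurable hm, h2.comp_measurable hm, h3.comp_measurable hm,
    h4.comp_measurable hm, h5.comp_measurable hm, h6.comp_measurable hm⟩

/-- Expected net energy consumption `E[e_t^u - e_t^h]`. -/
noncomputable def meanEnergy (P : Params) (μ : Measure Env) [IsProbabilityMeasure μ] (π : Policy)
    (t : ℕ) : ℝ := ∫ s, (P.eU (π.action t s) - (event t s).eh) ∂sampleLaw μ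

/-- Expected offloaded data. -/
noncomputable def meanOff (P : Params) (μ : Measure Env) [IsProbabilityMeasure μ] (π : Policy)
    (t : ℕ) : ℝ := ∫ s, P.lOff (event t s) (π.action t s) ∂sampleLaw μ

/-- Expected locally processed data. -/
noncomputable def meanLoc (P : Params) (μ : Measure Env) [IsProbabilityMeasure μ] (π : Policy)
    (t : ℕ) : ℝ := ∫ s, P.lLoc (π.action t s) ∂sampleLaw μ

/-- Expected data processed at the edge server. -/
noncomputable def meanProc (P : Params) (μ : Measure Env) [IsProbabilityMeasure μ] (π : Policy)
    (t : ℕ) : ℝ := ∫ s, P.lEdg (π.action t s) ∂sampleLaw μ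

section
variable (hP : P.Valid) (hμ : EnvLaw P μ) (hq₀ : q₀.Proper P)
  (hπ : ∀ t, ∀ᵐ s ∂sampleLaw μ, SlotFeasible P (π.queues P q₀ t s) (event t s) (π.action t s))
include hP hμ hq₀ hπ

lemma meanQU_succ (t : ℕ) : meanQU P μ q₀ π (t + 1)
    = meanQU P μ q₀ π t - (meanOff P μ π t + meanLoc P μ π t - meanRate μ π t) := by
  obtain ⟨i1, -, -, -, -⟩ := integrable_queues hP hμ hq₀ hπ t
  obtain ⟨h1, -, -, h4, h5, -⟩ := integrable_slot hP hμ hπ t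
  have e : meanQU P μ q₀ π (t + 1) = ∫ s, ((π.queues P q₀ t s).QU
      - P.lOff (event t s) (π.action t s) - P.lLoc (π.action t s) + (π.action t s).r)
      ∂sampleLaw μ := rfl
  rw [e, integral_add ((i1.sub' h4).sub' h5) h1, integral_sub (i1.sub' h4) h5,
    integral_sub i1 h4]
  unfold meanQU meanOff meanLoc meanRate
  ring

lemma meanQS_succ (t : ℕ) : meanQS P μ q₀ π (t + 1)
    = meanQS P μ q₀ π t - (meanProc P μ π t - meanOff P μ π t) := by
  obtain ⟨-, i1, -, -, -⟩ := integrable_queues hP hμ hq₀ hπ t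
  obtain ⟨-, -, -, h4, -, h6⟩ := integrable_slot hP hμ hπ t
  have e : meanQS P μ q₀ π (t + 1) = ∫ s, ((π.queues P q₀ t s).QS
      - P.lEdg (π.action t s) + P.lOff (event t s) (π.action t s)) ∂sampleLaw μ := rfl
  rw [e, integral_add (i1.sub' h6) h4, integral_sub i1 h6]
  unfold meanQS meanOff meanProc
  ring

/-- Capping the battery can only increase the deficit, so a sublinear deficit bounds the average net
consumption. -/
lemma meanDeficit_add_le (t : ℕ) : meanDeficit P μ q₀ π t + P.lamE * meanEnergy P μ π t
    ≤ meanDeficit P μ q₀ π (t + 1) := by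
  obtain ⟨-, -, i1, -, -⟩ := integrable_queues hP hμ hq₀ hπ t
  obtain ⟨-, -, i2, -, -⟩ := integrable_queues hP hμ hq₀ hπ (t + 1)
  obtain ⟨-, -, h3, -, -, -⟩ := integrable_slot hP hμ hπ t
  unfold meanDeficit meanEnergy
  rw [← integral_const_mul, ← integral_add i1 (h3.const_mul _)]
  refine integral_mono (i1.fun_add (h3.const_mul _)) i2 fun s => ?_
  simp only [Policy.queues, Queues.next]
  have := min_le_left ((π.queues P q₀ t s).B - P.lamE * P.eU (π.action t s)
    + P.lamE * (event t s).eh) P.cap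
  linarith

lemma meanDeficit_succ_le (t : ℕ) : meanDeficit P μ q₀ π (t + 1)
    ≤ meanDeficit P μ q₀ π t + P.lamE * P.eUMax := by
  obtain ⟨-, -, i1, -, -⟩ := integrable_queues hP hμ hq₀ hπ t
  obtain ⟨-, -, i2, -, -⟩ := integrable_queues hP hμ hq₀ hπ (t + 1)
  have e : meanDeficit P μ q₀ π t + P.lamE * P.eUMax
      = ∫ s, (P.cap - (π.queues P q₀ t s).B + P.lamE * P.eUMax) ∂sampleLaw μ := by
    rw [integral_add i1 (integrable_const _)]
    simp [meanDeficit]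
  rw [e]
  refine integral_mono_ae i2 (i1.fun_add (integrable_const _)) ?_
  filter_upwards [hπ t, hμ.regular_event t, ae_proper hP hμ hq₀ hπ t] with s ⟨_, _, hb⟩ hw hq
  have h1 := mul_le_mul_of_nonneg_left (eU_le_eUMax hP hb) hP.lamE_pos.le
  have h2 := mul_nonneg hP.lamE_pos.le hw.2.1
  have h3 := (mul_nonneg hP.lamE_pos.le (eU_nonneg hP hb)).trans h1
  have h4 := hq.B_le
  simp only [Policy.queues, Queues.next]
  rw [sub_le_comm]
  exact le_min (by linarith) (by linarith)

lemma meanZ_add_le (t : ℕ) : meanZ P μ q₀ π t + P.lamC * (meanEdg P μ π t - P.cth)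
    ≤ meanZ P μ q₀ π (t + 1) := by
  obtain ⟨-, -, -, i1, -⟩ := integrable_queues hP hμ hq₀ hπ t
  obtain ⟨-, -, -, i2, -⟩ := integrable_queues hP hμ hq₀ hπ (t + 1)
  obtain ⟨-, h2, -, -, -, -⟩ := integrable_slot hP hμ hπ t
  have i3 : Integrable (fun s => P.lamC * (P.eEdg (π.action t s) - P.cth)) (sampleLaw μ) :=
    (h2.sub (integrable_const _)).const_mul _
  have e : meanZ P μ q₀ π t + P.lamC * (meanEdg P μ π t - P.cth)
      = ∫ s, ((π.queues P q₀ t s).Z + P.lamC * (P.eEdg (π.action t s) - P.cth))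
        ∂sampleLaw μ := by
    rw [integral_add i1 i3, integral_const_mul, integral_sub h2 (integrable_const _)]
    simp [meanZ, meanEdg]
  rw [e]
  refine integral_mono (i1.fun_add i3) i2 fun s => ?_
  simp only [Policy.queues, Queues.next]
  have := le_max_left ((π.queues P q₀ t s).Z + P.lamC * P.eEdg (π.action t s)
    - P.lamC * P.cth) 0
  linarith

lemma meanZ_succ_le (t : ℕ) : meanZ P μ q₀ π (t + 1)
    ≤ meanZ P μ q₀ π t + P.lamC * P.eEdgMax := by
  obtain ⟨-, -, -, i1, -⟩ := integrable_queues hP hμ hq₀ hπ t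
  obtain ⟨-, -, -, i2, -⟩ := integrable_queues hP hμ hq₀ hπ (t + 1)
  have e : meanZ P μ q₀ π t + P.lamC * P.eEdgMax
      = ∫ s, ((π.queues P q₀ t s).Z + P.lamC * P.eEdgMax) ∂sampleLaw μ := by
    rw [integral_add i1 (integrable_const _)]
    simp [meanZ]
  rw [e]
  refine integral_mono_ae i2 (i1.fun_add (integrable_const _)) ?_
  filter_upwards [hπ t, ae_proper hP hμ hq₀ hπ t] with s ⟨_, _, hb⟩ hq
  have h1 := mul_le_mul_of_nonneg_left (eEdg_le_eEdgMax hP hb) hP.lamC_pos.le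
  have h2 := mul_nonneg hP.lamC_pos.le hP.cth_nonneg
  have h3 := (mul_nonneg hP.lamC_pos.le (eEdg_nonneg hP hb)).trans h1
  have h4 := hq.Z_nonneg
  simp only [Policy.queues, Queues.next]
  exact max_le (by linarith) (by linarith)

lemma meanQueues_nonneg (t : ℕ) : 0 ≤ meanQU P μ q₀ π t ∧ 0 ≤ meanQS P μ q₀ π t ∧
    0 ≤ meanDeficit P μ q₀ π t ∧ 0 ≤ meanZ P μ q₀ π t := by
  have h := ae_proper hP hμ hq₀ hπ t
  exact ⟨integral_nonneg_of_ae (h.mono fun s hs => hs.QU_nonneg),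
    integral_nonneg_of_ae (h.mono fun s hs => hs.QS_nonneg),
    integral_nonneg_of_ae (h.mono fun s hs => sub_nonneg.2 hs.B_le),
    integral_nonneg_of_ae (h.mono fun s hs => hs.Z_nonneg)⟩

omit hq₀ in
lemma meanRate_mem (t : ℕ) : 0 ≤ meanRate μ π t ∧ meanRate μ π t ≤ P.rmax := by
  obtain ⟨h1, -⟩ := integrable_slot hP hμ hπ t
  refine ⟨integral_nonneg_of_ae ((hπ t).mono fun s hs => hs.2.2.1.1), ?_⟩
  have : meanRate μ π t ≤ ∫ _, P.rmax ∂sampleLaw μ :=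
    integral_mono_ae h1 (integrable_const _) ((hπ t).mono fun s hs => hs.2.2.1.2)
  simpa using this

omit hq₀ in
/-- The offloaded data of a slot is bounded in mean. -/
lemma meanOff_mem (t : ℕ) : 0 ≤ meanOff P μ π t ∧
    meanOff P μ π t ≤ ∫ w, P.lOffMax w ∂μ := by
  obtain ⟨-, -, -, h4, -⟩ := integrable_slot hP hμ hπ t
  have hev := measurePreserving_event μ t
  have hi : Integrable P.lOffMax μ := hμ.lOffMax_memLp.integrable (by norm_num)
  have e : ∫ w, P.lOffMax w ∂μ = ∫ s, P.lOffMax (event t s) ∂sampleLaw μ := by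
    conv_lhs => rw [← hev.map_eq]
    rw [integral_map hev.measurable.aemeasurable]
    rw [hev.map_eq]; exact hi.aestronglyMeasurable
  rw [e]
  refine ⟨integral_nonneg_of_ae ?_, integral_mono_ae h4 (hev.integrable_comp_of_integrable hi) ?_⟩
  · filter_upwards [hπ t, hμ.regular_event t] with s hs hw using lOff_nonneg hP hw hs.2.2.2.1.1
  · filter_upwards [hπ t, hμ.regular_event t] with s hs hw using lOff_le_lOffMax hP hw hs.2.2

omit hq₀ in
lemma exists_limsupAvg_meanRate : ∃ v : ℝ, limsupAvg (meanRate μ π) = (v : EReal) ∧ v ≤ P.rmax := by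
  have h := meanRate_mem hP hμ hπ
  have h1 : limsupAvg (meanRate μ π) ≤ (P.rmax : EReal) :=
    limsupAvg_le_of_sum_le (c := 0) fun N => by
      have := Finset.sum_le_sum fun t (_ : t ∈ Finset.range N) => (h t).2
      simp only [Finset.sum_const, Finset.card_range, nsmul_eq_mul] at this
      linarith
  have h2 : ((0 : ℝ) : EReal) ≤ limsupAvg (meanRate μ π) :=
    (le_liminfAvg_of_le_sum (c := 0) fun N => by
      simpa using Finset.sum_nonneg fun t (_ : t ∈ Finset.range N) => (h t).1).trans
      (liminfAvg_le_limsupAvg _)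
  obtain ⟨v, hv⟩ := exists_coe_eq h2 h1
  exact ⟨v, hv, by rw [hv] at h1; exact_mod_cast h1⟩

end

end FeasibleRuns

/-! ### Stability, feasibility and near-optimality of PLySE -/

section Performance

variable {P : Params} {μ : Measure Env} [IsProbabilityMeasure μ] {q₀ : Queues} {π : Policy}
  {V ε φ : ℝ} {Γ : Kernel Env Action} [IsMarkovKernel Γ]

lemma IsPLySE.slotFeasible (hπ : IsPLySE P μ q₀ V π) (t : ℕ) :
    ∀ᵐ s ∂sampleLaw μ, SlotFeasible P (π.queues P q₀ t s) (event t s) (π.action t s) :=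
  (hπ t).mono fun _ h => h.1

lemma driftConst_nonneg (P : Params) (μ : Measure Env) : 0 ≤ P.driftConst μ := by
  have h1 : 0 ≤ ∫ w, (P.lOffMax w + P.lLocMax) ^ 2 ∂μ := integral_nonneg fun w => sq_nonneg _
  have h2 : 0 ≤ ∫ w, (P.lOffMax w) ^ 2 ∂μ := integral_nonneg fun w => sq_nonneg _
  unfold Params.driftConst
  positivity

lemma Slater.admissibleLaw (hΓ : Slater P μ ε φ Γ) : AdmissibleLaw P μ (μ ⊗ₘ Γ) :=
  ⟨Measure.fst_compProd μ Γ, hΓ.admissible⟩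

/-- Under the Slater condition, the backlogs of PLySE have a negative drift. -/
lemma Slater.sum_backlogs_le (hΓ : Slater P μ ε φ Γ) (hP : P.Valid) (hμ : EnvLaw P μ)
    (hq₀ : q₀.Proper P) (hπ : IsPLySE P μ q₀ V π) (N : ℕ) :
    ε * ∑ t ∈ Finset.range N, (P.lamC * meanZ P μ q₀ π t + P.lamE * meanDeficit P μ q₀ π t
      + meanQU P μ q₀ π t + meanQS P μ q₀ π t) ≤
      N * (P.driftConst μ - V * φ) + V * ∑ t ∈ Finset.range N, meanRate μ π t
        + lyapunov P q₀ := by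
  have hν := hΓ.admissibleLaw
  obtain ⟨-, -, -, jO, jl, -⟩ := hν.integrable hP hμ
  have step : ∀ t ∈ Finset.range N, ε * (P.lamC * meanZ P μ q₀ π t
      + P.lamE * meanDeficit P μ q₀ π t + meanQU P μ q₀ π t + meanQS P μ q₀ π t) ≤
      (P.driftConst μ - V * φ) + V * meanRate μ π t
        - (meanLyapunov P μ q₀ π (t + 1) - meanLyapunov P μ q₀ π t) := by
    intro t _
    have h := meanLyapunov_drift_le hP hμ hq₀ hπ hν t
    obtain ⟨n1, n2, n3, n4⟩ := meanQueues_nonneg hP hμ hq₀ hπ.slotFeasible t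
    have hs := hΓ.sensing
    rw [integral_add jO jl] at hs
    rw [hΓ.rate] at h hs
    -- Each slack `ε`, weighted by its nonnegative backlog, contributes to the negative drift.
    have k1 := mul_le_mul_of_nonneg_left hΓ.edge (mul_nonneg n4 hP.lamC_pos.le)
    have k2 := mul_le_mul_of_nonneg_left hΓ.energy (mul_nonneg n3 hP.lamE_pos.le)
    have k3 := mul_le_mul_of_nonneg_left hs n1
    have k4 := mul_le_mul_of_nonneg_left hΓ.offload n2
    linarith
  have hsum := Finset.sum_le_sum step
  rw [← Finset.mul_sum, Finset.sum_sub_distrib, Finset.sum_range_sub,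
    Finset.sum_add_distrib (f := fun _ => P.driftConst μ - V * φ)
      (g := fun t => V * meanRate μ π t), ← Finset.mul_sum, Finset.sum_const, Finset.card_range, nsmul_eq_mul] at hsum
  have h0 : meanLyapunov P μ q₀ π 0 = lyapunov P q₀ := by
    simp [meanLyapunov, Policy.queues]
  have hN : 0 ≤ meanLyapunov P μ q₀ π N := integral_nonneg fun s => lyapunov_nonneg _ _
  linarith

lemma limsupAvg_lt_top_of_sum_le {u : ℕ → ℝ} {a c k : ℝ} (hk : 0 < k)
    (h : ∀ N : ℕ, k * ∑ t ∈ Finset.range N, u t ≤ a * N + c) : limsupAvg u < ⊤ := by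
  refine (limsupAvg_le_of_sum_le (a := a / k) (c := c / k) fun N => ?_).trans_lt
    (EReal.coe_lt_top _)
  have : a / k * N + c / k = (a * N + c) / k := by ring
  rw [this, le_div_iff₀ hk, mul_comm]
  exact h N

/-- All averaged backlogs of PLySE are bounded. -/
lemma Slater.limsupAvg_lt_top (hΓ : Slater P μ ε φ Γ) (hP : P.Valid) (hμ : EnvLaw P μ)
    (hq₀ : q₀.Proper P) (hV : 0 < V) (hπ : IsPLySE P μ q₀ V π) :
    limsupAvg (meanQU P μ q₀ π) < ⊤ ∧ limsupAvg (meanQS P μ q₀ π) < ⊤ ∧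
      limsupAvg (meanDeficit P μ q₀ π) < ⊤ ∧ limsupAvg (meanZ P μ q₀ π) < ⊤ := by
  have hε := hΓ.ε_pos
  have hle := hP.lamE_pos
  have hlc := hP.lamC_pos
  -- The crude bound `rmax` on the rate is enough for stability. The sharper bound by `optP2` needs
  -- PLySE to be feasible, which is deduced from this stability.
  have hb : ∀ N : ℕ, ε * ∑ t ∈ Finset.range N, (P.lamC * meanZ P μ q₀ π t
      + P.lamE * meanDeficit P μ q₀ π t + meanQU P μ q₀ π t + meanQS P μ q₀ π t) ≤
      (P.driftConst μ - V * φ + V * P.rmax) * N + lyapunov P q₀ := by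
    intro N
    have h1 := hΓ.sum_backlogs_le hP hμ hq₀ hπ N
    have h2 := Finset.sum_le_sum fun t (_ : t ∈ Finset.range N) =>
      (meanRate_mem hP hμ hπ.slotFeasible t).2
    rw [Finset.sum_const, Finset.card_range, nsmul_eq_mul] at h2
    have h3 := mul_le_mul_of_nonneg_left h2 hV.le
    linarith
  have hn := meanQueues_nonneg hP hμ hq₀ hπ.slotFeasible
  have main : ∀ (u : ℕ → ℝ) (k : ℝ), 0 < k → (∀ t, k * u t ≤ P.lamC * meanZ P μ q₀ π t
      + P.lamE * meanDeficit P μ q₀ π t + meanQU P μ q₀ π t + meanQS P μ q₀ π t) →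
      limsupAvg u < ⊤ := by
    intro u k hk hu
    refine limsupAvg_lt_top_of_sum_le (mul_pos hε hk) fun N => le_trans ?_ (hb N)
    rw [mul_assoc, Finset.mul_sum]
    exact mul_le_mul_of_nonneg_left (Finset.sum_le_sum fun t _ => hu t) hε.le
  refine ⟨main _ 1 one_pos fun t => ?_, main _ 1 one_pos fun t => ?_, main _ _ hle fun t => ?_,
    main _ _ hlc fun t => ?_⟩ <;>
  · obtain ⟨n1, n2, n3, n4⟩ := hn t
    have := mul_nonneg hle.le n3
    have := mul_nonneg hlc.le n4
    linarith

lemma Slater.dataStable (hΓ : Slater P μ ε φ Γ) (hP : P.Valid) (hμ : EnvLaw P μ)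
    (hq₀ : q₀.Proper P) (hV : 0 < V) (hπ : IsPLySE P μ q₀ V π) : DataStable P μ q₀ π := by
  obtain ⟨h1, h2, -, -⟩ := hΓ.limsupAvg_lt_top hP hμ hq₀ hV hπ
  have hi := integrable_queues hP hμ hq₀ hπ.slotFeasible
  have hp := ae_proper hP hμ hq₀ hπ.slotFeasible
  exact ⟨.of_nonneg (fun t => (hi t).1) (fun t => (hp t).mono fun s h => h.QU_nonneg) h1,
    .of_nonneg (fun t => (hi t).2.1) (fun t => (hp t).mono fun s h => h.QS_nonneg) h2⟩

lemma Slater.stronglyStable_Z (hΓ : Slater P μ ε φ Γ) (hP : P.Valid) (hμ : EnvLaw P μ)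
    (hq₀ : q₀.Proper P) (hV : 0 < V) (hπ : IsPLySE P μ q₀ V π) :
    StronglyStable (sampleLaw μ) (fun t s => (π.queues P q₀ t s).Z) := by
  obtain ⟨-, -, -, h⟩ := hΓ.limsupAvg_lt_top hP hμ hq₀ hV hπ
  exact .of_nonneg (fun t => (integrable_queues hP hμ hq₀ hπ.slotFeasible t).2.2.2.1)
    (fun t => (ae_proper hP hμ hq₀ hπ.slotFeasible t).mono fun s h => h.Z_nonneg) h

/-- A queue that grows sublinearly and absorbs the increments `k * (u t - a)` forces the averages
of `u` to stay below `a`. -/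
lemma limsupAvg_le_of_queue {u q : ℕ → ℝ} {k a : ℝ} (hk : 0 < k) (hq0 : 0 ≤ q 0)
    (hq : ∀ t, q t + k * (u t - a) ≤ q (t + 1))
    (hlin : ∀ δ > 0, ∀ᶠ N : ℕ in atTop, q N ≤ δ * N) : limsupAvg u ≤ (a : EReal) := by
  refine limsupAvg_le_iff.2 fun δ hδ => ?_
  filter_upwards [hlin (k * δ) (mul_pos hk hδ)] with N hN
  have h := Finset.sum_le_sum fun t (_ : t ∈ Finset.range N) =>
    (by linarith [hq t] : k * (u t - a) ≤ q (t + 1) - q t)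
  rw [Finset.sum_range_sub, ← Finset.mul_sum, Finset.sum_sub_distrib, Finset.sum_const,
    Finset.card_range, nsmul_eq_mul] at h
  refine le_of_mul_le_mul_left ?_ hk
  linarith

lemma Slater.powerBudget (hΓ : Slater P μ ε φ Γ) (hP : P.Valid) (hμ : EnvLaw P μ)
    (hq₀ : q₀.Proper P) (hV : 0 < V) (hπ : IsPLySE P μ q₀ V π) : PowerBudget P μ π := by
  obtain ⟨-, -, -, h⟩ := hΓ.limsupAvg_lt_top hP hμ hq₀ hV hπ
  have hn := fun t => (meanQueues_nonneg hP hμ hq₀ hπ.slotFeasible t).2.2.2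
  exact limsupAvg_le_of_queue hP.lamC_pos (hn 0) (meanZ_add_le hP hμ hq₀ hπ.slotFeasible)
    fun δ hδ => eventually_le_mul_of_avg_bounded hn (meanZ_succ_le hP hμ hq₀ hπ.slotFeasible) h hδ

lemma Slater.commonFeasible (hΓ : Slater P μ ε φ Γ) (hP : P.Valid) (hμ : EnvLaw P μ)
    (hq₀ : q₀.Proper P) (hV : 0 < V) (hπ : IsPLySE P μ q₀ V π) : CommonFeasible P μ q₀ π :=
  ⟨hπ.slotFeasible, hΓ.dataStable hP hμ hq₀ hV hπ, hΓ.powerBudget hP hμ hq₀ hV hπ⟩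

/-- The battery deficit acts as the virtual queue of the relaxed energy constraint, so its bounded
averages enforce that constraint. -/
lemma Slater.feasibleP2 (hΓ : Slater P μ ε φ Γ) (hP : P.Valid) (hμ : EnvLaw P μ)
    (hq₀ : q₀.Proper P) (hV : 0 < V) (hπ : IsPLySE P μ q₀ V π) : FeasibleP2 P μ q₀ π := by
  refine ⟨hΓ.commonFeasible hP hμ hq₀ hV hπ, ?_⟩
  obtain ⟨-, -, h, -⟩ := hΓ.limsupAvg_lt_top hP hμ hq₀ hV hπ
  have hn := fun t => (meanQueues_nonneg hP hμ hq₀ hπ.slotFeasible t).2.2.1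
  exact limsupAvg_le_of_queue (u := meanEnergy P μ π) hP.lamE_pos (hn 0)
    (fun t => by simpa using meanDeficit_add_le hP hμ hq₀ hπ.slotFeasible t) fun δ hδ =>
      eventually_le_mul_of_avg_bounded hn (meanDeficit_succ_le hP hμ hq₀ hπ.slotFeasible) h hδ

lemma ae_battery_nonneg (hP : P.Valid) (hμ : EnvLaw P μ) (hq₀ : q₀.Valid P)
    (hec : AlwaysEnergyCausal P μ q₀ π) (t : ℕ) :
    ∀ᵐ s ∂sampleLaw μ, 0 ≤ (π.queues P q₀ t s).B := by
  induction t with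
  | zero => exact ae_of_all _ fun _ => hq₀.B_nonneg
  | succ t ih =>
    filter_upwards [ih, hec t, hμ.regular_event t] with s h1 ⟨h2, h3⟩ hw
    have h4 := mul_nonneg hP.lamE_pos.le hw.2.1
    refine le_min ?_ hP.cap_pos.le
    split_ifs at h3 <;> linarith

/-- Energy causality implies the long-term energy constraint. -/
lemma FeasibleP1.feasibleP2 (hP : P.Valid) (hμ : EnvLaw P μ) (hq₀ : q₀.Valid P)
    (hπ : FeasibleP1 P μ q₀ π) : FeasibleP2 P μ q₀ π := by
  refine ⟨hπ.1, ?_⟩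
  have hf := hπ.1.1
  have hn := fun t => (meanQueues_nonneg hP hμ hq₀.proper hf t).2.2.1
  refine limsupAvg_le_of_queue (u := meanEnergy P μ π) hP.lamE_pos (hn 0)
    (fun t => by simpa using meanDeficit_add_le hP hμ hq₀.proper hf t) fun δ hδ => ?_
  -- Energy causality keeps the battery nonnegative, so the deficit never exceeds the capacity.
  filter_upwards [eventually_const_le_mul P.cap hδ] with N hN
  refine le_trans ?_ hN
  have h1 : meanDeficit P μ q₀ π N ≤ ∫ _, P.cap ∂sampleLaw μ :=
    integral_mono_ae (integrable_queues hP hμ hq₀.proper hf N).2.2.1 (integrable_const _) <| by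
      filter_upwards [ae_battery_nonneg hP hμ hq₀ hπ.2 N] with s hs
      linarith
  simpa using h1

/-- The average backlogs of PLySE are controlled by its average sensing rate. -/
lemma Slater.limsupAvg_backlog_le (hΓ : Slater P μ ε φ Γ) (hP : P.Valid) (hμ : EnvLaw P μ)
    (hq₀ : q₀.Proper P) (hV : 0 < V) (hπ : IsPLySE P μ q₀ V π) {v : ℝ}
    (hv : limsupAvg (meanRate μ π) ≤ (v : EReal)) :
    limsupAvg (meanQU P μ q₀ π) ≤ (((P.driftConst μ + V * (v - φ)) / ε : ℝ) : EReal) ∧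
      limsupAvg (meanQS P μ q₀ π) ≤ (((P.driftConst μ + V * (v - φ)) / ε : ℝ) : EReal) := by
  have hε := hΓ.ε_pos
  have hn := meanQueues_nonneg hP hμ hq₀ hπ.slotFeasible
  have main : ∀ u : ℕ → ℝ, (∀ t, u t ≤ P.lamC * meanZ P μ q₀ π t
      + P.lamE * meanDeficit P μ q₀ π t + meanQU P μ q₀ π t + meanQS P μ q₀ π t) →
      limsupAvg u ≤ (((P.driftConst μ + V * (v - φ)) / ε : ℝ) : EReal) := by
    intro u hu
    refine limsupAvg_le_iff.2 fun δ hδ => ?_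
    -- One half of the tolerance `ε * δ` pays for the error in the rate after multiplication by `V`,
    -- the other half for the initial Lyapunov value.
    have hδ' : 0 < ε * δ / (2 * V) := by positivity
    filter_upwards [limsupAvg_le_iff.1 hv _ hδ',
      eventually_const_le_mul (lyapunov P q₀) (by positivity : 0 < ε * δ / 2)] with N h1 h2
    have h3 := hΓ.sum_backlogs_le hP hμ hq₀ hπ N
    have h4 := mul_le_mul_of_nonneg_left
      (Finset.sum_le_sum fun t (_ : t ∈ Finset.range N) => hu t) hε.le
    have h5 := mul_le_mul_of_nonneg_left h1 hV.le
    have e1 : V * ((v + ε * δ / (2 * V)) * N) = V * v * N + ε * δ / 2 * N := by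
      field_simp
    have e2 : ε * (((P.driftConst μ + V * (v - φ)) / ε + δ) * N)
        = (P.driftConst μ + V * (v - φ)) * N + ε * δ * N := by
      field_simp
    refine le_of_mul_le_mul_left ?_ hε
    rw [e2]
    rw [e1] at h5
    linarith
  refine ⟨main _ fun t => ?_, main _ fun t => ?_⟩ <;>
  · obtain ⟨n1, n2, n3, n4⟩ := hn t
    have := mul_nonneg hP.lamE_pos.le n3
    have := mul_nonneg hP.lamC_pos.le n4
    linarith

lemma sum_range_eq_of_succ {q a : ℕ → ℝ} (h : ∀ t, q (t + 1) = q t - a t) (N : ℕ) :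
    ∑ t ∈ Finset.range N, a t = q 0 - q N := by
  rw [← Finset.sum_range_sub']
  exact Finset.sum_congr rfl fun t _ => by linarith [h t]

/-- Drift of PLySE, compared with a policy that is feasible for (P2). -/
lemma meanLyapunov_drift_le_of_feasibleP2 (hP : P.Valid) (hμ : EnvLaw P μ) (hq₀ : q₀.Proper P)
    (hV : 0 < V) (hπ : IsPLySE P μ q₀ V π) {π' : Policy} (hπ' : FeasibleP2 P μ q₀ π') {v : ℝ}
    (hv : limsupAvg (meanRate μ π') = (v : EReal)) (t : ℕ) :
    meanLyapunov P μ q₀ π (t + 1) - meanLyapunov P μ q₀ π t - V * meanRate μ π t ≤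
      P.driftConst μ - V * v := by
  obtain ⟨⟨hf, ⟨hsU, hsS⟩, hpow⟩, hen⟩ := hπ'
  obtain ⟨n1, n2, n3, n4⟩ := meanQueues_nonneg hP hμ hq₀ hπ.slotFeasible t
  have hp := ae_proper hP hμ hq₀ hf
  have hn := meanQueues_nonneg hP hμ hq₀ hf
  have hlU := hsU.limsupAvg_lt_top fun t => (hp t).mono fun s h => h.QU_nonneg
  have hlS := hsS.limsupAvg_lt_top fun t => (hp t).mono fun s h => h.QS_nonneg
  have hincU : ∀ τ, meanQU P μ q₀ π' (τ + 1) ≤ meanQU P μ q₀ π' τ + P.rmax := by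
    intro τ
    have h1 := meanQU_succ hP hμ hq₀ hf τ
    have h2 := (meanRate_mem hP hμ hf τ).2
    have h3 := (meanOff_mem hP hμ hf τ).1
    have h4 : 0 ≤ meanLoc P μ π' τ :=
      integral_nonneg_of_ae ((hf τ).mono fun s h => lLoc_nonneg hP h.2.2)
    linarith
  have hincS : ∀ τ, meanQS P μ q₀ π' (τ + 1) ≤ meanQS P μ q₀ π' τ + ∫ w, P.lOffMax w ∂μ := by
    intro τ
    have h1 := meanQS_succ hP hμ hq₀ hf τ
    have h2 := (meanOff_mem hP hμ hf τ).2
    have h4 : 0 ≤ meanProc P μ π' τ :=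
      integral_nonneg_of_ae ((hf τ).mono fun s h => lEdg_nonneg hP h.2.2)
    linarith
  set A := meanLyapunov P μ q₀ π (t + 1) - meanLyapunov P μ q₀ π t - V * meanRate μ π t
  have hstep : ∀ τ, A ≤ P.driftConst μ - (V * meanRate μ π' τ
      + meanZ P μ q₀ π t * (P.lamC * (P.cth - meanEdg P μ π' τ))
      - meanDeficit P μ q₀ π t * (P.lamE * meanEnergy P μ π' τ)
      + meanQU P μ q₀ π t * (meanOff P μ π' τ + meanLoc P μ π' τ - meanRate μ π' τ)
      + meanQS P μ q₀ π t * (meanProc P μ π' τ - meanOff P μ π' τ)) := by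
    intro τ
    have h := meanLyapunov_drift_le hP hμ hq₀ hπ (admissibleLaw_slotLaw hf τ) t
    rw [integral_slotLaw (f := fun y => y.2.r) (by fun_prop),
      integral_slotLaw (f := fun y => P.eEdg y.2) (by fun_prop),
      integral_slotLaw (f := fun y => P.eU y.2 - y.1.eh) (by fun_prop),
      integral_slotLaw (f := fun y => P.lOff y.1 y.2) P.measurable_lOff,
      integral_slotLaw (f := fun y => P.lLoc y.2) (by fun_prop),
      integral_slotLaw (f := fun y => P.lEdg y.2) (by fun_prop)] at h
    exact h
  clear_value A
  -- Summing over `τ` telescopes the competitor's net departures into its own backlogs; the initial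
  -- backlogs have a favourable sign and are dropped.
  have hsum : ∀ M : ℕ, A * M ≤ P.driftConst μ * M - V * ∑ τ ∈ Finset.range M, meanRate μ π' τ
      + meanZ P μ q₀ π t * P.lamC * (∑ τ ∈ Finset.range M, meanEdg P μ π' τ - P.cth * M)
      + meanDeficit P μ q₀ π t * P.lamE * ∑ τ ∈ Finset.range M, meanEnergy P μ π' τ
      + meanQU P μ q₀ π t * meanQU P μ q₀ π' M + meanQS P μ q₀ π t * meanQS P μ q₀ π' M := by
    intro M
    have h := Finset.sum_le_sum fun τ (_ : τ ∈ Finset.range M) => hstep τ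
    rw [Finset.sum_sub_distrib, Finset.sum_add_distrib, Finset.sum_add_distrib,
      Finset.sum_sub_distrib, Finset.sum_add_distrib, ← Finset.mul_sum, ← Finset.mul_sum,
      ← Finset.mul_sum, ← Finset.mul_sum, ← Finset.mul_sum, ← Finset.mul_sum, ← Finset.mul_sum,
      sum_range_eq_of_succ (meanQU_succ hP hμ hq₀ hf), sum_range_eq_of_succ (meanQS_succ hP hμ hq₀ hf),
      Finset.sum_sub_distrib] at h
    simp only [Finset.sum_const, Finset.card_range, nsmul_eq_mul] at h
    have m1 := mul_nonneg n1 (hn 0).1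
    have m2 := mul_nonneg n2 (hn 0).2.1
    linarith
  -- `K` is the total weight of the five errors, so a tolerance of `η / K` for each adds up to `η`.
  set K := V + meanZ P μ q₀ π t * P.lamC + meanDeficit P μ q₀ π t * P.lamE
    + meanQU P μ q₀ π t + meanQS P μ q₀ π t with hK
  have hZ := mul_nonneg n4 hP.lamC_pos.le
  have hX := mul_nonneg n3 hP.lamE_pos.le
  have hKpos : 0 < K := by linarith
  refine le_of_forall_pos_le_add fun η hη => ?_
  have hδ : 0 < η / K := by positivity
  -- The competitor's rate is an upper limit, so it is nearly attained only for infinitely many `M`.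
  -- The other four estimates hold eventually, and a single common `M` suffices.
  have hfreq : ∃ᶠ M : ℕ in atTop, (v - η / K) * M ≤ ∑ τ ∈ Finset.range M, meanRate μ π' τ := by
    have h1 : ((v - η / K : ℝ) : EReal) < limsupAvg (meanRate μ π') := by
      rw [hv, EReal.coe_lt_coe_iff]; linarith
    refine ((frequently_lt_of_lt_limsup (by isBoundedDefault) h1).and_eventually
      (eventually_gt_atTop 0)).mono fun M hM => ?_
    have h2 := hM.1
    rw [EReal.coe_lt_coe_iff, lt_div_iff₀ (by exact_mod_cast hM.2)] at h2
    exact h2.le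
  have hen' : limsupAvg (meanEnergy P μ π') ≤ ((0 : ℝ) : EReal) := hen
  obtain ⟨M, h1, h2, h3, h4, h5, h6⟩ := (hfreq.and_eventually
    ((limsupAvg_le_iff.1 hpow _ hδ).and ((limsupAvg_le_iff.1 hen' _ hδ).and
    ((eventually_le_mul_of_avg_bounded (fun τ => (hn τ).1) hincU hlU hδ).and
    ((eventually_le_mul_of_avg_bounded (fun τ => (hn τ).2.1) hincS hlS hδ).and
      (eventually_gt_atTop 0)))))).exists
  have hM : (0 : ℝ) < M := by exact_mod_cast h6
  have k1 := mul_le_mul_of_nonneg_left h1 hV.le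
  have k2 := mul_le_mul_of_nonneg_left h2 hZ
  have k3 := mul_le_mul_of_nonneg_left h3 hX
  have k4 := mul_le_mul_of_nonneg_left h4 n1
  have k5 := mul_le_mul_of_nonneg_left h5 n2
  have hKδ : K * (η / K) = η := by field_simp
  have k6 : K * (η / K * M) = η * M := by rw [← mul_assoc, hKδ]
  refine le_of_mul_le_mul_right ?_ hM
  have := hsum M
  rw [hK] at k6
  linarith

/-- PLySE is within `D / V` of every policy that is feasible for (P2). -/
lemma le_liminfAvg_meanRate_of_feasibleP2 (hP : P.Valid) (hμ : EnvLaw P μ) (hq₀ : q₀.Proper P)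
    (hV : 0 < V) (hπ : IsPLySE P μ q₀ V π) {π' : Policy} (hπ' : FeasibleP2 P μ q₀ π') {v : ℝ}
    (hv : limsupAvg (meanRate μ π') = (v : EReal)) :
    ((v - P.driftConst μ / V : ℝ) : EReal) ≤ liminfAvg (meanRate μ π) := by
  refine le_liminfAvg_of_le_sum (c := lyapunov P q₀ / V) fun N => ?_
  have h := Finset.sum_le_sum fun t (_ : t ∈ Finset.range N) =>
    meanLyapunov_drift_le_of_feasibleP2 hP hμ hq₀ hV hπ hπ' hv t
  rw [Finset.sum_sub_distrib, Finset.sum_range_sub, ← Finset.mul_sum, Finset.sum_const,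
    Finset.card_range, nsmul_eq_mul] at h
  have h0 : meanLyapunov P μ q₀ π 0 = lyapunov P q₀ := by
    simp [meanLyapunov, Policy.queues]
  have hN : 0 ≤ meanLyapunov P μ q₀ π N := integral_nonneg fun s => lyapunov_nonneg _ _
  have e : V * ((v - P.driftConst μ / V) * N - lyapunov P q₀ / V)
      = (V * v - P.driftConst μ) * N - lyapunov P q₀ := by
    field_simp
  refine le_of_mul_le_mul_left ?_ hV
  rw [e]
  linarith

lemma optP1_sub_le_liminfAvg (hP : P.Valid) (hμ : EnvLaw P μ) (hq₀ : q₀.Valid P)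
    (hV : 0 < V) (hπ : IsPLySE P μ q₀ V π) :
    ((optP1 P μ q₀ - P.driftConst μ / V : ℝ) : EReal) ≤ liminfAvg (meanRate μ π) := by
  obtain ⟨u, hu, -⟩ := exists_limsupAvg_meanRate hP hμ hπ.slotFeasible
  have h0 : ((0 : ℝ) : EReal) ≤ liminfAvg (meanRate μ π) :=
    le_liminfAvg_of_le_sum (c := 0) fun N => by
      simpa using Finset.sum_nonneg fun t (_ : t ∈ Finset.range N) =>
        (meanRate_mem hP hμ hπ.slotFeasible t).1
  obtain ⟨l, hl⟩ := exists_coe_eq h0 ((liminfAvg_le_limsupAvg _).trans hu.le)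
  rw [hl, EReal.coe_le_coe_iff] at h0
  rw [hl, EReal.coe_le_coe_iff, sub_le_iff_le_add]
  -- If no policy is feasible for (P1), the real supremum takes the default value `0`; nonnegativity
  -- of the right side covers that case.
  refine Real.sSup_le ?_ (add_nonneg h0 (div_nonneg (driftConst_nonneg P μ) hV.le))
  rintro v ⟨π', hπ', hv⟩
  have := le_liminfAvg_meanRate_of_feasibleP2 hP hμ hq₀.proper hV hπ
    (hπ'.feasibleP2 hP hμ hq₀) hv
  rw [hl, EReal.coe_le_coe_iff] at this
  linarith

lemma limsupAvg_meanRate_le_optP2 (hP : P.Valid) (hμ : EnvLaw P μ) (hπ : FeasibleP2 P μ q₀ π) :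
    limsupAvg (meanRate μ π) ≤ (optP2 P μ q₀ : EReal) := by
  obtain ⟨v, hv, -⟩ := exists_limsupAvg_meanRate hP hμ hπ.1.1
  rw [hv, EReal.coe_le_coe_iff]
  refine le_csSup ⟨P.rmax, ?_⟩ ⟨π, hπ, hv⟩
  rintro w ⟨π', hπ', hw⟩
  obtain ⟨w', hw', hle⟩ := exists_limsupAvg_meanRate hP hμ hπ'.1.1
  rw [hw, EReal.coe_eq_coe_iff] at hw'
  exact hw' ▸ hle

lemma limsupAvg_meanRate_le_optP1 (hP : P.Valid) (hμ : EnvLaw P μ) (hπ : FeasibleP1 P μ q₀ π) :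
    limsupAvg (meanRate μ π) ≤ (optP1 P μ q₀ : EReal) := by
  obtain ⟨v, hv, -⟩ := exists_limsupAvg_meanRate hP hμ hπ.1.1
  rw [hv, EReal.coe_le_coe_iff]
  refine le_csSup ⟨P.rmax, ?_⟩ ⟨π, hπ, hv⟩
  rintro w ⟨π', hπ', hw⟩
  obtain ⟨w', hw', hle⟩ := exists_limsupAvg_meanRate hP hμ hπ'.1.1
  rw [hw, EReal.coe_eq_coe_iff] at hw'
  exact hw' ▸ hle

/-- With a large battery, PLySE respects energy causality. -/
lemma IsPLySE.alwaysEnergyCausal (hP : P.Valid) (hμ : EnvLaw P μ) (hq₀ : q₀.Valid P)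
    (hV : 0 < V) (hπ : IsPLySE P μ q₀ V π)
    (hcap : V / (P.lamE * P.eunit) + 3 * P.lamE * P.eUMax + 2 * (V + P.rmax) + P.Bmin ≤ P.cap)
    (hinit : q₀.QU = 0 ∨ (q₀.B = P.cap ∧ q₀.QU ≤ V + P.rmax)) :
    AlwaysEnergyCausal P μ q₀ π := by
  have hrm := hP.rmax_nonneg
  have hle := hP.lamE_pos
  have heu := hP.eunit_pos
  have h0 : EnergyReserve P V q₀ := by
    rcases hinit with h | ⟨h1, h2⟩
    · exact ⟨by rw [h]; linarith, hq₀.B_nonneg, Or.inl h⟩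
    · refine ⟨h2, hq₀.B_nonneg, Or.inr (Or.inl ?_)⟩
      have : 0 < V / (P.lamE * P.eunit) := by positivity
      rw [h1, deficitThreshold]
      linarith
  have hstep : ∀ t, ∀ᵐ s ∂sampleLaw μ, EnergyReserve P V (π.queues P q₀ t s) →
      EnergyCausal P (π.queues P q₀ t s) (π.action t s) ∧
        EnergyReserve P V (π.queues P q₀ (t + 1) s) := by
    intro t
    filter_upwards [hπ t, hμ.regular_event t, ae_proper hP hμ hq₀.proper hπ.slotFeasible t]
      with s h1 h2 h3 h4
    exact energyReserve_step hP h3 h2 hV h1.1 h1.2 hcap h4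
  have hres : ∀ t, ∀ᵐ s ∂sampleLaw μ, EnergyReserve P V (π.queues P q₀ t s) := by
    intro t
    induction t with
    | zero => exact ae_of_all _ fun _ => h0
    | succ t ih =>
      filter_upwards [ih, hstep t] with s h1 h2 using (h2 h1).2
  intro t
  filter_upwards [hres t, hstep t] with s h1 h2 using (h2 h1).1

end Performance

end EdgeSensing

/-! ### Assembly of the proposition -/

open EdgeSensing in
theorem proposition3 (P : Params) (hP : P.Valid)
    (μ : Measure Env) [IsProbabilityMeasure μ] (hμ : EnvLaw P μ)
    (q₀ : Queues) (hq₀ : q₀.Valid P)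
    (ε φ : ℝ) (Γ : Kernel Env Action) [IsMarkovKernel Γ] (hΓ : Slater P μ ε φ Γ) :
    (∀ (V : ℝ), 0 < V → ∀ (π : Policy), IsPLySE P μ q₀ V π →
      -- sensing rate
      ((optP1 P μ q₀ - P.driftConst μ / V : ℝ) : EReal) ≤ liminfAvg (meanRate μ π) ∧
      -- data queues
      (DataStable P μ q₀ π ∧
        limsupAvg (meanQU P μ q₀ π) ≤
          (((P.driftConst μ + V * (optP2 P μ q₀ - φ)) / ε : ℝ) : EReal) ∧
        limsupAvg (meanQS P μ q₀ π) ≤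
          (((P.driftConst μ + V * (optP2 P μ q₀ - φ)) / ε : ℝ) : EReal) ∧
        (AlwaysEnergyCausal P μ q₀ π →
          limsupAvg (meanQU P μ q₀ π) ≤
            (((P.driftConst μ + V * (optP1 P μ q₀ - φ)) / ε : ℝ) : EReal) ∧
          limsupAvg (meanQS P μ q₀ π) ≤
            (((P.driftConst μ + V * (optP1 P μ q₀ - φ)) / ε : ℝ) : EReal))) ∧
      -- energy causality for a large battery
      (V / (P.lamE * P.eunit) + 3 * P.lamE * P.eUMax + 2 * (V + P.rmax) + P.Bmin ≤ P.cap →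
        (q₀.QU = 0 ∨ (q₀.B = P.cap ∧ q₀.QU ≤ V + P.rmax)) → AlwaysEnergyCausal P μ q₀ π) ∧
      -- virtual queue and power constraint
      (StronglyStable (sampleLaw μ) (fun t s => (π.queues P q₀ t s).Z) ∧
        PowerBudget P μ π)) ∧
    -- `[O(1/V), O(V)]` tradeoff
    (∃ K : ℝ, ∀ (V : ℝ), 0 < V → ∀ (π : Policy), IsPLySE P μ q₀ V π →
      ((optP1 P μ q₀ - K / V : ℝ) : EReal) ≤ liminfAvg (meanRate μ π) ∧
      limsupAvg (meanQU P μ q₀ π) ≤ ((K * (1 + V) : ℝ) : EReal) ∧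
      limsupAvg (meanQS P μ q₀ π) ≤ ((K * (1 + V) : ℝ) : EReal)) := by
  have hq := hq₀.proper
  refine ⟨fun V hV π hπ => ⟨optP1_sub_le_liminfAvg hP hμ hq₀ hV hπ,
    ⟨hΓ.dataStable hP hμ hq hV hπ, ?_⟩, hπ.alwaysEnergyCausal hP hμ hq₀ hV,
    hΓ.stronglyStable_Z hP hμ hq hV hπ, hΓ.powerBudget hP hμ hq hV hπ⟩, ?_⟩
  · obtain ⟨h1, h2⟩ := hΓ.limsupAvg_backlog_le hP hμ hq hV hπ
      (limsupAvg_meanRate_le_optP2 hP hμ (hΓ.feasibleP2 hP hμ hq hV hπ))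
    exact ⟨h1, h2, fun hec => hΓ.limsupAvg_backlog_le hP hμ hq hV hπ
      (limsupAvg_meanRate_le_optP1 hP hμ ⟨hΓ.commonFeasible hP hμ hq hV hπ, hec⟩)⟩
  · have hD := driftConst_nonneg P μ
    have hε := hΓ.ε_pos
    have hDε : 0 ≤ P.driftConst μ / ε := by positivity
    have hrε : 0 ≤ |P.rmax - φ| / ε := by positivity
    -- The first summand serves the rate, the other two the backlogs. Bounding PLySE's rate by
    -- `rmax` keeps the constant free of the optimal values and of `V`.
    refine ⟨P.driftConst μ + P.driftConst μ / ε + |P.rmax - φ| / ε, fun V hV π hπ => ⟨?_, ?_⟩⟩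
    · refine le_trans (EReal.coe_le_coe_iff.2 ?_) (optP1_sub_le_liminfAvg hP hμ hq₀ hV hπ)
      gcongr
      linarith
    · obtain ⟨v, hv, hvr⟩ := exists_limsupAvg_meanRate hP hμ hπ.slotFeasible
      have hle : (P.driftConst μ + V * (v - φ)) / ε ≤
          (P.driftConst μ + P.driftConst μ / ε + |P.rmax - φ| / ε) * (1 + V) := by
        have h1 : V * (v - φ) ≤ V * |P.rmax - φ| :=
          mul_le_mul_of_nonneg_left ((by linarith : v - φ ≤ P.rmax - φ).trans (le_abs_self _)) hV.le
        have h2 : (P.driftConst μ + V * (v - φ)) / ε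
            ≤ P.driftConst μ / ε + V * (|P.rmax - φ| / ε) := by
          rw [← mul_div_assoc, ← add_div]
          gcongr
        have h3 := mul_nonneg hDε hV.le
        have h4 := mul_nonneg hD hV.le
        linarith
      obtain ⟨h1, h2⟩ := hΓ.limsupAvg_backlog_le hP hμ hq hV hπ hv.le
      exact ⟨h1.trans (EReal.coe_le_coe_iff.2 hle), h2.trans (EReal.coe_le_coe_iff.2 hle)⟩
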